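/- **Hedonic diversity games.** An instance consists of $n\ge 1$ agents $N=\{1,\dots,n\}$ partitioned into nonempty colour classes $D_1,\dots,D_\gamma$, and for every agent $i$ a weak order $\succeq_i$ (a total preorder) on the set of all palettes, where the palette of a nonempty coalition $X\subseteq N$ is $\bigl(|D_c\cap X|/|X|\bigr)_{c=1}^{\gamma}$; agents compare coalitions by comparing their palettes. The instance also contains integers $\sigma,\rho_{\ge1},\rho_{\ge2}\ge 0$. The number $\tau$ of agent types is the number of different preference lists among $\succeq_1,\dots,\succeq_n$. The preferences are given in the oracle model: the explicit input is the colouring together with the three integers, and an oracle answers, for an agent $i$ and nonempty coalitions $C,D$, whether $C\succeq_i D$. An outcome is a partition $\Pi$ of $N$ into nonempty coalitions; $\Pi_i$ is the coalition that contains $i$. Agent $i$ admits an NS-deviation to $C$, where $C\in\Pi$ or $C=\emptyset$, if $C\cup\{i\}\succ_i\Pi_i$; it is an IS-deviation if, in addition, $C\cup\{i\}\succeq_j C$ for every $j\in C$. The outcome is Nash stable (individually stable) if no agent admits an NS-deviation (IS-deviation). The problem HDG-Nash (HDG-Individual) asks whether there is a Nash stable (individually stable) outcome with at most $\rho_{\ge1}$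 coalitions, at most $\rho_{\ge2}$ of them with more than one agent, and all of size at most $\sigma$. **Theorem.** HDG-Nash and HDG-Individual are both $\mathrm{W}[1]$-hard when parameterized by $\gamma+\rho_{\ge1}+\tau$. Here $\mathrm{W}[1]$ is the class of parameterized problems that have a parameterized reduction to Weighted 2-CNF-Satisfiability (is there a satisfying assignment with exactly $k$ true variables? parameter $k$). Hardness means that every problem in $\mathrm{W}[1]$ has a parameterized reduction to the given problem: a map $(x,k)\mapsto I$ that preserves yes- and no-instances, such that the parameter of $I$ is at most $h(k)$ for a computable function $h$, the explicit part of $I$ and its parameter are computable in time $f(k)\cdot|x|^{O(1)}$, and the answer of the oracle of $I$ to a query $q$ is computable from $(x,k,q)$ in time $f(k)\cdot(|x|+|q|)^{O(1)}$, for a computable function $f$. -/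

import Mathlib

/-! ### Machine model: multi-stack machines in structured form, with step counting -/

namespace Machine

/-- A memory: stack number `r` holds the word `s r` over the alphabet `{0, 1}`; the top of the
stack is the head of the list. Every program uses only finitely many of the stacks. -/
abbrev Store : Type := ℕ → List Bool

/-- Programs of a multi-stack machine (equivalently, up to a constant factor in the running time,
of a multi-tape Turing machine: a two-way infinite tape is a pair of stacks). -/
inductive Prog : Type
  | skip : Prog
  | push (r : ℕ) (b : Bool) : Prog
  | pop (r : ℕ) : Prog
  | seq (p q : Prog) : Prog
  /-- three-way branch: stack `r` is empty / has top `0` / has top `1` -/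
  | branch (r : ℕ) (pEmpty pZero pOne : Prog) : Prog
  /-- repeat the body as long as stack `r` is not empty -/
  | loop (r : ℕ) (p : Prog) : Prog

/-- `Exec p s s' t`: started in memory `s`, the program `p` halts in memory `s'` after exactly `t`
steps. Every elementary instruction and every test costs one step. -/
inductive Exec : Prog → Store → Store → ℕ → Prop
  | skip (s : Store) : Exec Prog.skip s s 1
  | push (s : Store) (r : ℕ) (b : Bool) :
      Exec (Prog.push r b) s (Function.update s r (b :: s r)) 1
  | pop (s : Store) (r : ℕ) :
      Exec (Prog.pop r) s (Function.update s r (s r).tail) 1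
  | seq {p q : Prog} {s₁ s₂ s₃ : Store} {t₁ t₂ : ℕ} :
      Exec p s₁ s₂ t₁ → Exec q s₂ s₃ t₂ → Exec (Prog.seq p q) s₁ s₃ (t₁ + t₂)
  | branchEmpty {r : ℕ} {p₀ p₁ p₂ : Prog} {s s' : Store} {t : ℕ} :
      s r = [] → Exec p₀ s s' t → Exec (Prog.branch r p₀ p₁ p₂) s s' (t + 1)
  | branchZero {r : ℕ} {p₀ p₁ p₂ : Prog} {s s' : Store} {t : ℕ} {w : List Bool} :
      s r = false :: w → Exec p₁ s s' t → Exec (Prog.branch r p₀ p₁ p₂) s s' (t + 1)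
  | branchOne {r : ℕ} {p₀ p₁ p₂ : Prog} {s s' : Store} {t : ℕ} {w : List Bool} :
      s r = true :: w → Exec p₂ s s' t → Exec (Prog.branch r p₀ p₁ p₂) s s' (t + 1)
  | loopStop {r : ℕ} {p : Prog} {s : Store} :
      s r = [] → Exec (Prog.loop r p) s s 1
  | loopStep {r : ℕ} {p : Prog} {s₁ s₂ s₃ : Store} {t₁ t₂ : ℕ} :
      s₁ r ≠ [] → Exec p s₁ s₂ t₁ → Exec (Prog.loop r p) s₂ s₃ t₂ →
        Exec (Prog.loop r p) s₁ s₃ (t₁ + t₂ + 1)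

/-- A natural number in unary. -/
def unary (k : ℕ) : List Bool := List.replicate k true

/-- The initial memory: the three given words on the stacks `0`, `1`, `2`, all other stacks
empty. -/
def initStore (a b c : List Bool) : Store
  | 0 => a
  | 1 => b
  | 2 => c
  | _ => []

end Machine

/-! ### Parameterized problems, parameterized reductions, `W[1]` -/

namespace ParamComplexity

open Machine

/-- A parameterized problem: a set of pairs (input word, parameter). -/
abbrev ParamProblem : Type := Set (List Bool × ℕ)

/-- `g` is computable in time `f(k) * |x|^O(1)` for a computable `f`. The machine gets the word
`x` and the parameter `k` (in unary), and leaves the output word on stack `0` and the output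
parameter (in unary) on stack `1`. -/
def FPTComputable (g : List Bool → ℕ → List Bool × ℕ) : Prop :=
  ∃ (p : Prog) (f : ℕ → ℕ) (c : ℕ), Computable f ∧
    ∀ (x : List Bool) (k : ℕ), ∃ (s : Store) (t : ℕ),
      Exec p (initStore x (unary k) []) s t ∧
      s 0 = (g x k).1 ∧ s 1 = unary (g x k).2 ∧
      t ≤ f k * (x.length + 1) ^ c

/-- Parameterized (many-one) reductions between parameterized problems. -/
def ParamReduces (P Q : ParamProblem) : Prop :=
  ∃ g : List Bool → ℕ → List Bool × ℕ,
    FPTComputable g ∧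
    (∃ h : ℕ → ℕ, Computable h ∧ ∀ x k, (g x k).2 ≤ h k) ∧
    ∀ x k, (x, k) ∈ P ↔ g x k ∈ Q

/-- Self-delimiting unary code of a natural number. -/
def encNat (m : ℕ) : List Bool := unary m ++ [false]

/-- A formula in conjunctive normal form over the variables `0, …, numVars - 1`, each clause being
a disjunction of two (possibly equal) literals; a literal is a variable with its sign (`true` for
a positive literal). -/
structure TwoCNF : Type where
  numVars : ℕ
  clauses : List ((Fin numVars × Bool) × (Fin numVars × Bool))

/-- The assignment `a` satisfies every clause. -/
def TwoCNF.SatisfiedBy (φ : TwoCNF) (a : Fin φ.numVars → Bool) : Prop :=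
  ∀ C ∈ φ.clauses, a C.1.1 = C.1.2 ∨ a C.2.1 = C.2.2

/-- The encoding of a formula as a word. -/
def TwoCNF.encode (φ : TwoCNF) : List Bool :=
  encNat φ.numVars ++ φ.clauses.flatMap fun C =>
    (C.1.2 :: encNat C.1.1) ++ (C.2.2 :: encNat C.2.1)

/-- Weighted 2-CNF-Satisfiability, parameterized by the weight `k`: is there a satisfying
assignment that sets exactly `k` variables to true? -/
def weightedTwoCNFSat : ParamProblem :=
  {I | ∃ φ : TwoCNF, I.1 = φ.encode ∧ ∃ a : Fin φ.numVars → Bool,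
    φ.SatisfiedBy a ∧ (Finset.univ.filter fun v => a v = true).card = I.2}

/-- The class `W[1]`: the parameterized problems that have a parameterized reduction to Weighted
2-CNF-Satisfiability. -/
def W1 : Set ParamProblem := {P | ParamReduces P weightedTwoCNFSat}

/-- A parameterized decision problem in the oracle model. An instance consists of an explicit
input word and of an oracle that answers yes/no queries about the instance. -/
structure OracleParamProblem : Type 1 where
  Instance : Type
  /-- the explicit part of the input -/
  input : Instance → List Bool
  /-- the admissible queries to the oracle of an instance, written as words -/
  Query : Instance → Type
  encQuery : ∀ I, Query I → List Bool
  /-- the answers of the oracle -/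
  answer : ∀ I, Query I → Prop
  param : Instance → ℕ
  yes : Set Instance

/-- The explicit part of `g x k`, with its parameter, is computable in time `f(k) * |x|^O(1)`, and
the oracle of `g x k` is given by an algorithm: from `x`, `k` and a query `q` to this oracle, the
answer is computable in time `f(k) * (|x| + |q|)^O(1)`. -/
def OracleFPTComputable (Q : OracleParamProblem) (g : List Bool → ℕ → Q.Instance) : Prop :=
  FPTComputable (fun x k => (Q.input (g x k), Q.param (g x k))) ∧
  ∃ (p : Prog) (f : ℕ → ℕ) (c : ℕ), Computable f ∧
    ∀ (x : List Bool) (k : ℕ) (q : Q.Query (g x k)), ∃ (s : Store) (t : ℕ) (b : Bool),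
      Exec p (initStore x (unary k) (Q.encQuery (g x k) q)) s t ∧
      s 0 = [b] ∧ (b = true ↔ Q.answer (g x k) q) ∧
      t ≤ f k * (x.length + (Q.encQuery (g x k) q).length + 1) ^ c

/-- Parameterized reductions to a problem in the oracle model. -/
def ReducesToOracle (P : ParamProblem) (Q : OracleParamProblem) : Prop :=
  ∃ g : List Bool → ℕ → Q.Instance,
    OracleFPTComputable Q g ∧
    (∃ h : ℕ → ℕ, Computable h ∧ ∀ x k, Q.param (g x k) ≤ h k) ∧
    ∀ x k, (x, k) ∈ P ↔ g x k ∈ Q.yes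

/-- `W[1]`-hardness: every problem in `W[1]` has a parameterized reduction to `Q`. -/
def W1Hard (Q : OracleParamProblem) : Prop := ∀ P ∈ W1, ReducesToOracle P Q

end ParamComplexity

/-! ### Hedonic diversity games -/

namespace HDG

open ParamComplexity

/-- The palette of a set of agents: the fraction of agents of each colour. -/
def palette {n γ : ℕ} (color : Fin n → Fin γ) (X : Finset (Fin n)) : Fin γ → ℚ :=
  fun c => ((X.filter fun a => color a = c).card : ℚ) / (X.card : ℚ)

/-- The set of all palettes (of non-empty coalitions). -/
def Palette {n γ : ℕ} (color : Fin n → Fin γ) : Type :=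
  {p : Fin γ → ℚ // ∃ X : Finset (Fin n), X.Nonempty ∧ palette color X = p}

/-- The palette of a non-empty coalition, as an element of the set of all palettes. -/
def Palette.of {n γ : ℕ} (color : Fin n → Fin γ) (X : Finset (Fin n)) (hX : X.Nonempty) :
    Palette color :=
  ⟨palette color X, X, hX, rfl⟩

/-- An instance of the hedonic diversity game problem: `n` agents, partitioned into `γ` colour
classes; for each agent a weak order (a total preorder, `pref i p q` meaning `p ⪰ᵢ q`) on the set
of all palettes; bounds on the size of a coalition, on the number of coalitions and on the number
of non-trivial coalitions. -/
structure Instance : Type where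
  n : ℕ
  n_pos : 0 < n
  γ : ℕ
  color : Fin n → Fin γ
  color_surjective : Function.Surjective color
  pref : Fin n → Palette color → Palette color → Prop
  pref_total : ∀ i p q, pref i p q ∨ pref i q p
  pref_trans : ∀ i p q r, pref i p q → pref i q r → pref i p r
  maxSize : ℕ
  maxCoalitions : ℕ
  maxNontrivial : ℕ

namespace Instance

variable (G : Instance)

/-- Agent `i` likes coalition `C` at least as much as coalition `D`. -/
def WeakPref (i : Fin G.n) (C D : Finset (Fin G.n)) : Prop :=
  ∃ (hC : C.Nonempty) (hD : D.Nonempty),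
    G.pref i (Palette.of G.color C hC) (Palette.of G.color D hD)

/-- Agent `i` strictly prefers coalition `C` to coalition `D`. -/
def StrictPref (i : Fin G.n) (C D : Finset (Fin G.n)) : Prop :=
  G.WeakPref i C D ∧ ¬ G.WeakPref i D C

/-- An outcome: a partition of the set of agents into (non-empty) coalitions. -/
abbrev Outcome : Type := Finpartition (Finset.univ : Finset (Fin G.n))

variable {G}

/-- Agent `i` admits an NS-deviation to `C`, a coalition of the outcome or the empty one;
`Π.part i` is the coalition of agent `i`. -/
def NSDeviation (P : G.Outcome) (i : Fin G.n) (C : Finset (Fin G.n)) : Prop :=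
  (C ∈ P.parts ∨ C = ∅) ∧ G.StrictPref i (insert i C) (P.part i)

/-- An NS-deviation that every member of the joined coalition accepts. -/
def ISDeviation (P : G.Outcome) (i : Fin G.n) (C : Finset (Fin G.n)) : Prop :=
  NSDeviation P i C ∧ ∀ j ∈ C, G.WeakPref j (insert i C) C

def NashStable (P : G.Outcome) : Prop := ∀ i C, ¬ NSDeviation P i C

def IndividuallyStable (P : G.Outcome) : Prop := ∀ i C, ¬ ISDeviation P i C

/-- The outcome respects the three bounds of the instance. -/
def Admissible (P : G.Outcome) : Prop :=
  P.parts.card ≤ G.maxCoalitions ∧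
  (P.parts.filter fun C => C.card ≠ 1).card ≤ G.maxNontrivial ∧
  ∀ C ∈ P.parts, C.card ≤ G.maxSize

variable (G)

/-- The number of agent types: the number of different preference lists. -/
noncomputable def numTypes : ℕ := (Set.range G.pref).ncard

/-- The explicit part of the input: the number of colours, the three bounds, and the colour of
each agent. -/
def encode : List Bool :=
  encNat G.γ ++ encNat G.maxSize ++ encNat G.maxCoalitions ++ encNat G.maxNontrivial ++
    (List.ofFn fun i => encNat (G.color i)).flatten

/-- A query to the preference oracle: an agent and two non-empty coalitions. -/
structure Query : Type where
  agent : Fin G.n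
  left : Finset (Fin G.n)
  right : Finset (Fin G.n)
  left_nonempty : left.Nonempty
  right_nonempty : right.Nonempty

/-- A query as a word: the agent in unary and the two coalitions as characteristic vectors. -/
def encodeQuery (q : G.Query) : List Bool :=
  encNat q.agent ++ (List.ofFn fun a => decide (a ∈ q.left)) ++
    (List.ofFn fun a => decide (a ∈ q.right))

end Instance

/-- The problem of deciding whether there is an admissible outcome that is stable in the sense
`stable`, in the oracle model, parameterized by (number of colours) + (maximum number of
coalitions, including trivial ones) + (number of agent types). -/
noncomputable def problem (stable : ∀ G : Instance, G.Outcome → Prop) : OracleParamProblem where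
  Instance := Instance
  input := fun G => G.encode
  Query := fun G => G.Query
  encQuery := fun G q => G.encodeQuery q
  answer := fun G q => G.WeakPref q.agent q.left q.right
  param := fun G => G.γ + G.maxCoalitions + G.numTypes
  yes := {G | ∃ P : G.Outcome, Instance.Admissible P ∧ stable G P}

/-- Nash-stable hedonic diversity game, parameterized by `γ + ρ≥1 + τ`. -/
noncomputable def nash : OracleParamProblem := problem fun _ P => Instance.NashStable P

/-- Individually stable hedonic diversity game, parameterized by `γ + ρ≥1 + τ`. -/
noncomputable def individual : OracleParamProblem :=
  problem fun _ P => Instance.IndividuallyStable P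

end HDG

/-! The reduction starts from Weighted 2-CNF-Satisfiability and hides a whole assignment in the
palette of a single coalition. For an instance `(x, k)` put `N = |x| + 2`. There is one agent `0`
with a colour of its own, and there are `k + 1` further colours with `N` agents each. If a coalition
contains agent `0`, the fraction of that agent's colour is the reciprocal of the size, so the
palette reveals the size and then the number of members of every colour
(`utility_eq_of_palette_eq`). These `k + 1` numbers are read as lengths of runs of zeros, each run
closed by a one. In this way they describe an arbitrary word that begins with a one and has `k + 1`
ones (`exists_blockWord`). Deleting the leading one and a guard zero after it leaves an assignment
of weight `k`. Thus `k + 2` colours encode every assignment of weight `k`, although the number of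
variables is unbounded.

All agents except `0` are indifferent, so there are two types. Agent `0` ranks coalitions with the
word of a satisfying assignment highest, then being alone, then everything else. At most two
coalitions are allowed, and the size bound prevents the other agents from forming a single
coalition; hence agent `0` is never alone. If its coalition is not acceptable, it leaves for the
empty coalition, and nobody can object: individual stability already forces a satisfying assignment
(`exists_coalition_of_individuallyStable`). Conversely, a coalition `X` built from a satisfying
assignment gives the partition of `X` and its complement, in which agent `0` has its optimum and
nobody else cares: this is Nash stable (`exists_nashStable`). One construction therefore serves
every stability notion between the two. The parameter is `(k + 2) + 2 + 2 = k + 6`.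

The rest is computability. An evaluator reads the code `x` symbol by symbol while a cursor runs over
the assignment. It rejects malformed codes too, so `x` need not be validated separately. Explicit
stack programs write the input (`runs_inputProg`) and answer oracle queries (`runs_oracleProg`) in
cubic time. Membership in `W[1]` supplies a reduction to weighted satisfiability, whose machine is
run first on a separate set of stacks (`runs_afterProg`). -/

namespace Machine

/-! ### Running programs with a time bound -/

/-- Started in `s`, the program halts in `s'` after at most `T` steps. -/
def Runs (p : Prog) (s s' : Store) (T : ℕ) : Prop := ∃ t ≤ T, Exec p s s' t

/-- Each step adds at most one symbol to a stack. This bounds the output length of a given reduction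
by its running time. -/
theorem Exec.length_le {p : Prog} {s s' : Store} {t : ℕ} (h : Exec p s s' t) (r : ℕ) :
    (s' r).length ≤ (s r).length + t := by
  induction h with
  | push s r' b =>
    by_cases hr : r = r'
    · subst hr; simp
    · simp [Function.update_of_ne hr]
  | pop s r' =>
    by_cases hr : r = r'
    · subst hr; simp; omega
    · simp [Function.update_of_ne hr]
  | _ => omega

/-- The program with all its stack numbers increased by `d`. -/
def Prog.shift (d : ℕ) : Prog → Prog
  | .skip => .skip
  | .push r b => .push (r + d) b
  | .pop r => .pop (r + d)
  | .seq p q => .seq (p.shift d) (q.shift d)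
  | .branch r p q u => .branch (r + d) (p.shift d) (q.shift d) (u.shift d)
  | .loop r p => .loop (r + d) (p.shift d)

/-- The memory with stacks `0, …, d - 1` as in `lo`, followed by the stacks of `hi`. -/
def join (d : ℕ) (lo hi : Store) : Store := fun r => if r < d then lo r else hi (r - d)

@[simp] theorem join_add (d : ℕ) (lo hi : Store) (r : ℕ) : join d lo hi (r + d) = hi r := by
  simp [join]

theorem update_join_add (d : ℕ) (lo hi : Store) (r : ℕ) (v : List Bool) :
    Function.update (join d lo hi) (r + d) v = join d lo (Function.update hi r v) := by
  funext i
  by_cases hi' : i < d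
  · have : i ≠ r + d := by omega
    simp [join, hi', Function.update_of_ne this]
  · by_cases h : i = r + d
    · subst h; simp
    · have h2 : i - d ≠ r := by omega
      simp [join, hi', Function.update_of_ne h, Function.update_of_ne h2]

/-- A program reaches stacks only through their numbers, so renumbering commutes with execution and
the first `d` stacks stay untouched. A given reduction can thus run above the sixteen registers. -/
theorem Exec.shift {p : Prog} {s s' : Store} {t : ℕ} (h : Exec p s s' t) (d : ℕ) (lo : Store) :
    Exec (p.shift d) (join d lo s) (join d lo s') t := by
  induction h with
  | skip s => exact .skip _
  | push s r b =>
    have := Exec.push (join d lo s) (r + d) b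
    rwa [update_join_add, join_add] at this
  | pop s r =>
    have := Exec.pop (join d lo s) (r + d)
    rwa [update_join_add, join_add] at this
  | seq _ _ h1 h2 => exact .seq h1 h2
  | branchEmpty hr _ ih => exact .branchEmpty (by simpa using hr) ih
  | branchZero hr _ ih => exact .branchZero (by simpa using hr) ih
  | branchOne hr _ ih => exact .branchOne (by simpa using hr) ih
  | loopStop hr => exact .loopStop (by simpa using hr)
  | loopStep hr _ _ h1 h2 => exact .loopStep (by simpa using hr) h1 h2

theorem Runs.mono {p : Prog} {s s' : Store} {T T' : ℕ} (h : Runs p s s' T) (hT : T ≤ T') :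
    Runs p s s' T' := by
  obtain ⟨t, ht, h⟩ := h
  exact ⟨t, ht.trans hT, h⟩

theorem Runs.congr {p : Prog} {s s' s'' : Store} {T : ℕ} (h : Runs p s s' T) (hs : s' = s'') :
    Runs p s s'' T := hs ▸ h

theorem Runs.skip {s : Store} : Runs .skip s s 1 := ⟨1, le_rfl, .skip s⟩

theorem Runs.seq {p q : Prog} {s₁ s₂ s₃ : Store} {T₁ T₂ : ℕ} (h₁ : Runs p s₁ s₂ T₁)
    (h₂ : Runs q s₂ s₃ T₂) : Runs (.seq p q) s₁ s₃ (T₁ + T₂) := by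
  obtain ⟨t₁, ht₁, h₁⟩ := h₁
  obtain ⟨t₂, ht₂, h₂⟩ := h₂
  exact ⟨t₁ + t₂, by omega, .seq h₁ h₂⟩

theorem Runs.branchEmpty {r : ℕ} {p₀ p₁ p₂ : Prog} {s s' : Store} {T : ℕ} (hr : s r = [])
    (h : Runs p₀ s s' T) : Runs (.branch r p₀ p₁ p₂) s s' (T + 1) := by
  obtain ⟨t, ht, h⟩ := h
  exact ⟨t + 1, by omega, .branchEmpty hr h⟩

theorem Runs.branchZero {r : ℕ} {p₀ p₁ p₂ : Prog} {s s' : Store} {T : ℕ} {w : List Bool}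
    (hr : s r = false :: w) (h : Runs p₁ s s' T) : Runs (.branch r p₀ p₁ p₂) s s' (T + 1) := by
  obtain ⟨t, ht, h⟩ := h
  exact ⟨t + 1, by omega, .branchZero hr h⟩

theorem Runs.branchOne {r : ℕ} {p₀ p₁ p₂ : Prog} {s s' : Store} {T : ℕ} {w : List Bool}
    (hr : s r = true :: w) (h : Runs p₂ s s' T) : Runs (.branch r p₀ p₁ p₂) s s' (T + 1) := by
  obtain ⟨t, ht, h⟩ := h
  exact ⟨t + 1, by omega, .branchOne hr h⟩

theorem Runs.loopNil {r : ℕ} {p : Prog} {s : Store} (hr : s r = []) : Runs (.loop r p) s s 1 :=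
  ⟨1, le_rfl, .loopStop hr⟩

theorem Runs.loopCons {r : ℕ} {p : Prog} {s₁ s₂ s₃ : Store} {T₁ T₂ : ℕ} {b : Bool}
    {w : List Bool} (hr : s₁ r = b :: w) (h₁ : Runs p s₁ s₂ T₁) (h₂ : Runs (.loop r p) s₂ s₃ T₂) :
    Runs (.loop r p) s₁ s₃ (T₁ + T₂ + 1) := by
  obtain ⟨t₁, ht₁, h₁⟩ := h₁
  obtain ⟨t₂, ht₂, h₂⟩ := h₂
  exact ⟨t₁ + t₂ + 1, by omega, .loopStep (by simp [hr]) h₁ h₂⟩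

theorem Runs.push (s : Store) (r : ℕ) (b : Bool) :
    Runs (.push r b) s (Function.update s r (b :: s r)) 1 := ⟨1, le_rfl, .push s r b⟩

theorem Runs.pop (s : Store) (r : ℕ) :
    Runs (.pop r) s (Function.update s r (s r).tail) 1 := ⟨1, le_rfl, .pop s r⟩

/-! ### Moving and clearing stacks -/

/-- Move the top of stack `a` to stack `b`. -/
def moveTop (a b : ℕ) : Prog :=
  .seq (.branch a .skip (.push b false) (.push b true)) (.pop a)

/-- Move the content of stack `a` to stack `b`, reversing it. -/
def move (a b : ℕ) : Prog := .loop a (moveTop a b)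

/-- Empty stack `a`. -/
def clear (a : ℕ) : Prog := .loop a (.pop a)

/-- Empty stack `a`, pushing a `1` on stack `b` for every removed symbol. -/
def drain (a b : ℕ) : Prog := .loop a (.seq (.pop a) (.push b true))

theorem runs_moveTop {a b : ℕ} (hab : a ≠ b) {s : Store} {c : Bool} {w : List Bool}
    (h : s a = c :: w) :
    Runs (moveTop a b) s (Function.update (Function.update s b (c :: s b)) a w) 3 := by
  have key : Runs (.branch a .skip (.push b false) (.push b true)) s
      (Function.update s b (c :: s b)) 2 := by
    cases c
    · exact .branchZero h (.push s b false)
    · exact .branchOne h (.push s b true)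
  refine (key.seq (.pop _ a)).congr ?_
  rw [Function.update_of_ne hab, h, List.tail_cons]

theorem runs_move {a b : ℕ} (hab : a ≠ b) (s : Store) :
    Runs (move a b) s (Function.update (Function.update s b ((s a).reverse ++ s b)) a [])
      (4 * (s a).length + 1) := by
  generalize hw : s a = w
  induction w generalizing s with
  | nil =>
    refine (Runs.loopNil hw).congr ?_
    rw [List.reverse_nil, List.nil_append, Function.update_eq_self, ← hw, Function.update_eq_self]
  | cons c w ih =>
    have h1 := runs_moveTop hab hw
    have h2 := ih _ (Function.update_self a w (Function.update s b (c :: s b)))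
    refine ((Runs.loopCons hw h1 h2).mono (by simp; omega)).congr ?_
    funext i
    by_cases hia : i = a
    · subst hia; simp
    · by_cases hib : i = b
      · subst hib; simp [hia]
      · simp [hia, hib]

theorem runs_drain {a b : ℕ} (hab : a ≠ b) (s : Store) :
    Runs (drain a b) s (Function.update (Function.update s b (unary (s a).length ++ s b)) a [])
      (3 * (s a).length + 1) := by
  generalize hw : s a = w
  induction w generalizing s with
  | nil =>
    refine (Runs.loopNil hw).congr ?_
    rw [show unary ([] : List Bool).length ++ s b = s b from rfl, Function.update_eq_self, ← hw, Function.update_eq_self]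
  | cons c w ih =>
    have h1 := (Runs.pop s a).seq (Runs.push _ b true)
    rw [hw, List.tail_cons] at h1
    have h2 := ih (Function.update (Function.update s a w) b
      (true :: Function.update s a w b)) (by simp [hab])
    refine ((Runs.loopCons hw h1 h2).mono (by simp; omega)).congr ?_
    funext i
    by_cases hia : i = a
    · subst hia; simp
    · by_cases hib : i = b
      · subst hib
        simp only [Function.update_self, Function.update_of_ne hia, unary, List.length_cons]
        rw [List.replicate_succ', List.append_assoc]
        rfl
      · simp [hia, hib]

theorem runs_clear (a : ℕ) (s : Store) :
    Runs (clear a) s (Function.update s a []) (2 * (s a).length + 1) := by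
  generalize hw : s a = w
  induction w generalizing s with
  | nil =>
    refine (Runs.loopNil hw).congr ?_
    rw [← hw]
    simp
  | cons c w ih =>
    have h1 := Runs.pop s a
    rw [hw, List.tail_cons] at h1
    have h2 := ih (Function.update s a w) (by simp)
    exact ((Runs.loopCons hw h1 h2).mono (by simp; omega)).congr (by simp)

/-! ### A bank of sixteen registers -/

/-- The contents of the stacks `0, …, 15`. -/
structure Regs : Type where
  r0 : List Bool := []
  r1 : List Bool := []
  r2 : List Bool := []
  r3 : List Bool := []
  r4 : List Bool := []
  r5 : List Bool := []
  r6 : List Bool := []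
  r7 : List Bool := []
  r8 : List Bool := []
  r9 : List Bool := []
  r10 : List Bool := []
  r11 : List Bool := []
  r12 : List Bool := []
  r13 : List Bool := []
  r14 : List Bool := []
  r15 : List Bool := []

def Regs.get (R : Regs) : Store
  | 0 => R.r0
  | 1 => R.r1
  | 2 => R.r2
  | 3 => R.r3
  | 4 => R.r4
  | 5 => R.r5
  | 6 => R.r6
  | 7 => R.r7
  | 8 => R.r8
  | 9 => R.r9
  | 10 => R.r10
  | 11 => R.r11
  | 12 => R.r12
  | 13 => R.r13
  | 14 => R.r14
  | 15 => R.r15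
  | _ => []

def Regs.set (R : Regs) (r : ℕ) (v : List Bool) : Regs :=
  match r with
  | 0 => { R with r0 := v }
  | 1 => { R with r1 := v }
  | 2 => { R with r2 := v }
  | 3 => { R with r3 := v }
  | 4 => { R with r4 := v }
  | 5 => { R with r5 := v }
  | 6 => { R with r6 := v }
  | 7 => { R with r7 := v }
  | 8 => { R with r8 := v }
  | 9 => { R with r9 := v }
  | 10 => { R with r10 := v }
  | 11 => { R with r11 := v }
  | 12 => { R with r12 := v }
  | 13 => { R with r13 := v }
  | 14 => { R with r14 := v }
  | 15 => { R with r15 := v }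
  | _ => R

/-- The memory with the registers `R` on the stacks `0, …, 15`, followed by the stacks of `hi`. -/
def Regs.store (R : Regs) (hi : Store) : Store := join 16 R.get hi

theorem Regs.store_apply (R : Regs) (hi : Store) {r : ℕ} (hr : r < 16) :
    R.store hi r = R.get r := by
  simp [Regs.store, join, hr]

theorem Regs.get_set (R : Regs) {r : ℕ} (hr : r < 16) (v : List Bool) :
    (R.set r v).get = Function.update R.get r v := by
  funext i
  by_cases hi : i < 16
  · interval_cases r <;> interval_cases i <;> rfl
  · obtain ⟨j, rfl⟩ : ∃ j, i = j + 16 := ⟨i - 16, by omega⟩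
    have : j + 16 ≠ r := by omega
    rw [Function.update_of_ne this]
    rfl

theorem Regs.update_store (R : Regs) (hi : Store) {r : ℕ} (hr : r < 16) (v : List Bool) :
    Function.update (R.store hi) r v = (R.set r v).store hi := by
  funext i
  simp only [Regs.store, join, R.get_set hr]
  by_cases h : i = r
  · subst h; simp [hr]
  · rw [Function.update_of_ne h]
    simp [join, Function.update_of_ne h]

section

variable (R : Regs) (hi : Store)

/-- With the low stacks as fields of a record, the memory after a straight-line program is found by
unification and compared by computation. The stacks `hi` are arbitrary, so leftovers of an earlier
program do no harm. -/
theorem Runs.pushR (r : ℕ) (b : Bool) (hr : r < 16 := by decide) :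
    Runs (.push r b) (R.store hi) ((R.set r (b :: R.get r)).store hi) 1 := by
  have := Runs.push (R.store hi) r b
  rwa [R.update_store hi hr, R.store_apply hi hr] at this

theorem Runs.popR (r : ℕ) (hr : r < 16 := by decide) :
    Runs (.pop r) (R.store hi) ((R.set r (R.get r).tail).store hi) 1 := by
  have := Runs.pop (R.store hi) r
  rwa [R.update_store hi hr, R.store_apply hi hr] at this

theorem Runs.moveR (a b : ℕ) (hab : a ≠ b := by decide) (ha : a < 16 := by decide)
    (hb : b < 16 := by decide) :
    Runs (move a b) (R.store hi)
      (((R.set b ((R.get a).reverse ++ R.get b)).set a []).store hi)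
      (4 * (R.get a).length + 1) := by
  have := runs_move hab (R.store hi)
  rwa [R.update_store hi hb, Regs.update_store _ hi ha, R.store_apply hi ha,
    R.store_apply hi hb] at this

theorem Runs.moveTopR (a b : ℕ) {c : Bool} {w : List Bool} (h : R.get a = c :: w)
    (hab : a ≠ b := by decide) (ha : a < 16 := by decide) (hb : b < 16 := by decide) :
    Runs (moveTop a b) (R.store hi)
      (((R.set b (c :: R.get b)).set a w).store hi) 3 := by
  have := runs_moveTop hab (s := R.store hi) (by rwa [R.store_apply hi ha])
  rwa [R.update_store hi hb, Regs.update_store _ hi ha, R.store_apply hi hb] at this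

theorem Runs.drainR (a b : ℕ) (hab : a ≠ b := by decide) (ha : a < 16 := by decide)
    (hb : b < 16 := by decide) :
    Runs (drain a b) (R.store hi)
      (((R.set b (unary (R.get a).length ++ R.get b)).set a []).store hi)
      (3 * (R.get a).length + 1) := by
  have := runs_drain hab (R.store hi)
  rwa [R.update_store hi hb, Regs.update_store _ hi ha, R.store_apply hi ha,
    R.store_apply hi hb] at this

theorem Runs.clearR (a : ℕ) (ha : a < 16 := by decide) :
    Runs (clear a) (R.store hi) ((R.set a []).store hi) (2 * (R.get a).length + 1) := by
  have := runs_clear a (R.store hi)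
  rwa [R.update_store hi ha, R.store_apply hi ha] at this

end

end Machine

namespace ParamComplexity

/-! ### Checking an assignment word against the code of a formula, symbol by symbol -/

/-- What the evaluator is reading: the number of variables, the sign of a literal, or the variable
of a literal with the given sign. -/
inductive EvalMode : Type
  | header : EvalMode
  | sign : EvalMode
  | var (s : Bool) : EvalMode

/-- The state of the evaluator. The assignment is `done.reverse ++ rest`; `second` says that the
second literal of a clause is being read, `sat` that its first literal is true, `bad` that the
formula is malformed or violated. -/
structure EvalState : Type where
  rest : List Bool
  done : List Bool
  mode : EvalMode
  second : Bool
  sat : Bool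
  bad : Bool

namespace EvalState

/-- Numbers are unary, so each one that is read moves the cursor past one variable. Stopping exactly
at the end is not yet an error: the header requires it, and a variable is rejected later by
`compare`. -/
def advance (s : EvalState) : EvalState :=
  match s.rest with
  | [] => { s with bad := true }
  | b :: w => { s with rest := w, done := b :: s.done }

def rewind (s : EvalState) : EvalState :=
  { s with rest := s.done.reverse ++ s.rest, done := [] }

/-- Compare the variable at the current position with the sign `c`. -/
def compare (c : Bool) (s : EvalState) : EvalState :=
  match s.rest with
  | [] => { s with bad := true }
  | b :: _ => { s with sat := s.sat || b == c }

def endLiteral (s : EvalState) : EvalState :=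
  if s.second then { s with second := false, sat := false, bad := s.bad || !s.sat }
  else { s with second := true }

/-- The declared number of variables must equal the length of the assignment, so the cursor must be
at the end. -/
def endHeader (s : EvalState) : EvalState :=
  { s with bad := s.bad || !s.rest.isEmpty }

def setMode (m : EvalMode) (s : EvalState) : EvalState := { s with mode := m }

def step (s : EvalState) (b : Bool) : EvalState :=
  match s.mode with
  | .header => if b then s.advance else s.endHeader.rewind.setMode .sign
  | .sign => s.setMode (.var b)
  | .var c => if b then s.advance else ((s.compare c).rewind.endLiteral).setMode .sign

/-- The first two conditions exclude codes that break off inside a number or between the literals of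
a clause. -/
def accepting (s : EvalState) : Prop := s.mode = .sign ∧ s.second = false ∧ s.bad = false

/-- The state before reading the formula. -/
def init (w : List Bool) : EvalState where
  -- The leading one and the guard zero are not part of the assignment.
  rest := w.tail.tail
  done := []
  mode := .header
  second := false
  sat := false
  bad := w.tail.head? != some false

/-! ### The evaluator on unary numbers and literals -/

theorem step_bad {s : EvalState} (h : s.bad = true) (b : Bool) : (s.step b).bad = true := by
  obtain ⟨rest, done, mode, second, sat, bad⟩ := s
  simp only at h
  subst h
  cases mode <;> cases b <;> cases rest <;> cases second <;>
    simp [step, advance, rewind, compare, endLiteral, endHeader, setMode]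

theorem foldl_step_bad (y : List Bool) {s : EvalState} (h : s.bad = true) :
    (y.foldl step s).bad = true := by
  induction y generalizing s with
  | nil => exact h
  | cons b y ih => exact ih (step_bad h b)

theorem foldl_step_advance {m : EvalMode} (hm : m ≠ .sign) (v : ℕ) (rest done : List Bool)
    (second sat bad : Bool) (hv : v ≤ rest.length) :
    (List.replicate v true).foldl step ⟨rest, done, m, second, sat, bad⟩ =
      ⟨rest.drop v, (rest.take v).reverse ++ done, m, second, sat, bad⟩ := by
  induction v generalizing rest done with
  | zero => simp
  | succ v ih =>
    cases rest with
    | nil => simp at hv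
    | cons b rest =>
      have h1 : step ⟨b :: rest, done, m, second, sat, bad⟩ true =
          ⟨rest, b :: done, m, second, sat, bad⟩ := by
        cases m with
        | sign => exact absurd rfl hm
        | _ => rfl
      rw [List.replicate_succ, List.foldl_cons, h1, ih rest (b :: done) (by simpa using hv)]
      simp

theorem foldl_step_advance_bad {m : EvalMode} (hm : m ≠ .sign) (v : ℕ) (rest done : List Bool)
    (second sat bad : Bool) (hv : rest.length < v) :
    ((List.replicate v true).foldl step ⟨rest, done, m, second, sat, bad⟩).bad = true := by
  obtain ⟨u, rfl⟩ : ∃ u, v = rest.length + (u + 1) := ⟨v - rest.length - 1, by omega⟩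
  rw [List.replicate_add, List.foldl_append, foldl_step_advance hm _ _ _ _ _ _ le_rfl,
    List.replicate_succ, List.foldl_cons]
  apply foldl_step_bad
  cases m with
  | sign => exact absurd rfl hm
  | _ => simp [step, advance]

/-- Only a zero ends a number. Hence a code that breaks off inside a number does not end in mode
`sign` and is not accepted. -/
theorem foldl_step_mode {m : EvalMode} (hm : m ≠ .sign) (v : ℕ) (rest done : List Bool)
    (second sat bad : Bool) :
    ((List.replicate v true).foldl step ⟨rest, done, m, second, sat, bad⟩).mode = m := by
  induction v generalizing rest done bad with
  | zero => rfl
  | succ v ih =>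
    rw [List.replicate_succ, List.foldl_cons]
    cases m with
    | sign => exact absurd rfl hm
    | _ => cases rest <;> exact ih _ _ _

/-- The state between two literals. -/
def between (w : List Bool) (second sat : Bool) : EvalState := ⟨w, [], .sign, second, sat, false⟩

theorem foldl_step_literal (w : List Bool) (second sat c : Bool) (v : ℕ) (y : List Bool)
    (hv : v < w.length) :
    (c :: (List.replicate v true ++ false :: y)).foldl step (between w second sat) =
      y.foldl step (endLiteral (between w second (sat || w[v] == c))) := by
  have h1 : step (between w second sat) c = ⟨w, [], .var c, second, sat, false⟩ := rfl
  rw [List.foldl_cons, h1, List.foldl_append,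
    foldl_step_advance (by simp) _ _ _ _ _ _ hv.le, List.foldl_cons]
  congr 1
  rw [List.drop_eq_getElem_cons hv]
  have h2 : ∀ (u d : List Bool) (b : Bool), step ⟨b :: u, d, .var c, second, sat, false⟩ false =
      endLiteral (between (d.reverse ++ b :: u) second (sat || b == c)) := by
    intro u d b
    cases second <;> rfl
  rw [h2]
  simp

/-- A variable beyond the range pushes the cursor off the end; one equal to the length leaves the
cursor at the end, where there is nothing to compare. -/
theorem foldl_step_literal_bad (w : List Bool) (second sat c : Bool) (v : ℕ) (y : List Bool)
    (hv : w.length ≤ v) :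
    ((c :: (List.replicate v true ++ false :: y)).foldl step (between w second sat)).bad =
      true := by
  have h1 : step (between w second sat) c = ⟨w, [], .var c, second, sat, false⟩ := rfl
  rw [List.foldl_cons, h1, List.foldl_append]
  rcases hv.lt_or_eq with hv | rfl
  · exact foldl_step_bad _ (foldl_step_advance_bad (by simp) _ _ _ _ _ _ hv)
  · rw [foldl_step_advance (by simp) _ _ _ _ _ _ le_rfl, List.foldl_cons]
    apply foldl_step_bad
    cases second <;> simp [step, compare, rewind, endLiteral, setMode]

end EvalState

/-! ### Accepted words are codes of satisfied formulas -/

theorem exists_replicate_true (y : List Bool) :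
    (∃ v, y = List.replicate v true) ∨ ∃ v z, y = List.replicate v true ++ false :: z := by
  induction y with
  | nil => exact .inl ⟨0, rfl⟩
  | cons b y ih =>
    cases b with
    | false => exact .inr ⟨0, y, rfl⟩
    | true =>
      rcases ih with ⟨v, rfl⟩ | ⟨v, z, rfl⟩
      · exact .inl ⟨v + 1, rfl⟩
      · exact .inr ⟨v + 1, z, rfl⟩

open EvalState

/-- The code of a clause. -/
def encClause {m : ℕ} (C : (Fin m × Bool) × (Fin m × Bool)) : List Bool :=
  (C.1.2 :: encNat C.1.1) ++ (C.2.2 :: encNat C.2.1)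

/-- Each satisfied clause brings the evaluator back to the state in which it started. -/
theorem accepting_of_clauses (w : List Bool)
    (cs : List ((Fin w.length × Bool) × (Fin w.length × Bool)))
    (h : ∀ C ∈ cs, w[C.1.1] = C.1.2 ∨ w[C.2.1] = C.2.2) :
    ((cs.flatMap encClause).foldl step (between w false false)).accepting := by
  induction cs with
  | nil => exact ⟨rfl, rfl, rfl⟩
  | cons C cs ih =>
    obtain ⟨⟨v, b⟩, ⟨u, c⟩⟩ := C
    have e : (((v, b), (u, c)) :: cs).flatMap encClause =
        b :: (List.replicate v true ++ false :: (c :: (List.replicate u true ++ false ::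
          cs.flatMap encClause))) := by
      simp [encClause, encNat, Machine.unary]
    have h1 : endLiteral (between w false (false || w[(v : ℕ)] == b)) =
      between w true (w[(v : ℕ)] == b) := rfl
    have hs := h _ List.mem_cons_self
    have h2 : endLiteral (between w true ((w[(v : ℕ)] == b) || w[(u : ℕ)] == c)) =
        between w false false := by
      have : ((w[(v : ℕ)] == b) || w[(u : ℕ)] == c) = true := by simpa using hs
      rw [this]; rfl
    rw [e, foldl_step_literal _ _ _ _ _ _ v.2, h1, foldl_step_literal _ _ _ _ _ _ u.2, h2]
    exact ih fun C hC => h C (List.mem_cons_of_mem _ hC)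

/-- The code is parsed clause by clause. Each way to fail (truncation, index out of range, violated
clause) contradicts acceptance. The bound `m` allows induction on the length, since a clause removes
several symbols. -/
theorem exists_clauses_of_accepting (w : List Bool) (m : ℕ) (y : List Bool) (hy : y.length ≤ m)
    (h : (y.foldl step (between w false false)).accepting) :
    ∃ cs : List ((Fin w.length × Bool) × (Fin w.length × Bool)), y = cs.flatMap encClause ∧
      ∀ C ∈ cs, w[C.1.1] = C.1.2 ∨ w[C.2.1] = C.2.2 := by
  induction m generalizing y with
  | zero =>
    obtain rfl : y = [] := by simpa using hy
    exact ⟨[], rfl, by simp⟩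
  | succ m ih =>
    have notVar : ∀ (c second sat : Bool) (v : ℕ),
        ¬ ((c :: List.replicate v true).foldl step (between w second sat)).accepting := by
      intro c second sat v h
      have h1 : step (between w second sat) c = ⟨w, [], .var c, second, sat, false⟩ := rfl
      have := h.1
      rw [List.foldl_cons, h1, foldl_step_mode (by simp)] at this
      simp at this
    have lit : ∀ (c second sat : Bool) (v : ℕ) (z : List Bool),
        ((c :: (List.replicate v true ++ false :: z)).foldl step
          (between w second sat)).accepting → v < w.length := by
      intro c second sat v z h
      by_contra hv
      have := foldl_step_literal_bad w second sat c v z (not_lt.mp hv)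
      rw [h.2.2] at this
      simp at this
    cases y with
    | nil => exact ⟨[], rfl, by simp⟩
    | cons b y =>
      rcases exists_replicate_true y with ⟨v, rfl⟩ | ⟨v, z, rfl⟩
      · exact absurd h (notVar _ _ _ _)
      · have hv := lit _ _ _ _ _ h
        rw [foldl_step_literal _ _ _ _ _ _ hv] at h
        change (z.foldl step (between w true (w[v] == b))).accepting at h
        -- After one literal the flag `second` is set, so the code cannot end here.
        cases z with
        | nil => simp [accepting, between] at h
        | cons c z =>
          rcases exists_replicate_true z with ⟨u, rfl⟩ | ⟨u, z, rfl⟩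
          · exact absurd h (notVar _ _ _ _)
          · have hu := lit _ _ _ _ _ h
            rw [foldl_step_literal _ _ _ _ _ _ hu] at h
            by_cases hsat : ((w[v] == b) || w[u] == c) = true
            · rw [hsat] at h
              obtain ⟨cs, hcs, hC⟩ := ih z (by simp at hy ⊢; omega) h
              refine ⟨((⟨v, hv⟩, b), (⟨u, hu⟩, c)) :: cs, ?_, ?_⟩
              · rw [List.flatMap_cons, ← hcs]
                simp [encClause, encNat, Machine.unary]
              · intro C hmem
                rcases List.mem_cons.mp hmem with rfl | hmem
                · simpa using hsat
                · exact hC C hmem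
            · have hb : ((endLiteral (between w true ((w[v] == b) || w[u] == c))).bad) = true := by
                simp only [Bool.not_eq_true] at hsat
                rw [hsat]; rfl
              have := foldl_step_bad z hb
              rw [h.2.2] at this
              simp at this

/-- The word `w` consists of the symbols `1`, `0` and a satisfying assignment of the formula with
code `x`. -/
def Accepts (x w : List Bool) : Prop := (x.foldl step (init w)).accepting

theorem foldl_header (w y : List Bool) :
    (List.replicate w.length true ++ false :: y).foldl step
        ⟨w, [], .header, false, false, false⟩ = y.foldl step (between w false false) := by
  rw [List.foldl_append, foldl_step_advance (by simp) _ _ _ _ _ _ le_rfl, List.foldl_cons]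
  congr 1
  simp [step, endHeader, rewind, setMode, between]

theorem accepts_ofFn (φ : TwoCNF) (a : Fin φ.numVars → Bool) (h : φ.SatisfiedBy a) (b : Bool) :
    Accepts φ.encode (b :: false :: List.ofFn a) := by
  obtain ⟨m, cs⟩ := φ
  simp only at a
  obtain ⟨w, hw⟩ : ∃ w, w = List.ofFn a := ⟨_, rfl⟩
  have hm : m = w.length := by simp [hw]
  subst hm
  have ha : ∀ i, a i = w[i] := by
    intro i
    have := List.getElem_ofFn (f := a) (i := i) (by simp)
    simp only [← hw] at this
    exact this.symm
  have := accepting_of_clauses w cs (fun C hC => by simpa [ha] using h C hC)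
  rw [← hw]
  unfold Accepts
  have e : TwoCNF.encode ⟨w.length, cs⟩ =
      List.replicate w.length true ++ false :: cs.flatMap encClause := by
    simp only [TwoCNF.encode, encNat, Machine.unary, List.append_assoc]
    rfl
  have e2 : init (b :: false :: w) = ⟨w, [], .header, false, false, false⟩ := rfl
  rw [e, e2, foldl_header]
  exact this

theorem Accepts.exists_satisfied {x w : List Bool} (h : Accepts x w) :
    ∃ φ : TwoCNF, x = φ.encode ∧ ∃ a : Fin φ.numVars → Bool, φ.SatisfiedBy a ∧
      w.tail = false :: List.ofFn a := by
  unfold Accepts at h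
  have hb : (init w).bad = false := by
    by_contra hb
    have := foldl_step_bad x (s := init w) (by simpa using hb)
    rw [h.2.2] at this
    simp at this
  obtain ⟨u, hu⟩ : ∃ u, w.tail = false :: u := by
    cases hw : w.tail with
    | nil => simp [init, hw] at hb
    | cons c u =>
      simp [init, hw] at hb
      exact ⟨u, by rw [hb]⟩
  have e : init w = ⟨u, [], .header, false, false, false⟩ := by simp [init, hu]
  rw [e] at h
  rcases exists_replicate_true x with ⟨v, rfl⟩ | ⟨v, y, rfl⟩
  · have := h.1
    rw [foldl_step_mode (by simp)] at this
    simp at this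
  -- A header that is too small leaves variables unread at its end; one that is too large runs off
  -- the assignment.
  · have hv : v = u.length := by
      rcases lt_trichotomy v u.length with hv | hv | hv
      · rw [List.foldl_append, foldl_step_advance (by simp) _ _ _ _ _ _ hv.le,
          List.foldl_cons] at h
        have := foldl_step_bad y (s := step ⟨u.drop v, (u.take v).reverse ++ [], .header, false,
          false, false⟩ false) (by simp [step, endHeader, rewind, setMode, hv])
        rw [h.2.2] at this
        simp at this
      · exact hv
      · rw [List.foldl_append] at h
        have := foldl_step_bad (false :: y) (foldl_step_advance_bad (m := .header) (by simp) v u []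
          false false false hv)
        rw [h.2.2] at this
        simp at this
    subst hv
    rw [foldl_header] at h
    obtain ⟨cs, hcs, hC⟩ := exists_clauses_of_accepting u _ y le_rfl h
    refine ⟨⟨u.length, cs⟩, ?_, fun i => u[i], hC, ?_⟩
    · simp only [TwoCNF.encode, encNat, Machine.unary, hcs, List.append_assoc]
      rfl
    · rw [hu]
      congr 1
      exact (List.ofFn_getElem (xs := u)).symm

end ParamComplexity

theorem List.count_true_ofFn {n : ℕ} (f : Fin n → Bool) :
    (List.ofFn f).count true = (Finset.univ.filter fun i => f i = true).card := by
  induction n with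
  | zero => simp
  | succ n ih =>
    rw [List.ofFn_succ, List.count_cons, ih, Finset.card_filter, Finset.card_filter,
      Fin.sum_univ_succ, add_comm]
    simp

namespace HDG

open ParamComplexity

/-! ### Coalitions as words -/

/-- Append (at the front) a block of `m` zeros that is closed by a one. -/
def addBlock (w : List Bool) (m : ℕ) : List Bool := true :: (List.replicate m false ++ w)

/-- The word whose blocks of zeros have the given lengths. -/
def blockWord (ms : List ℕ) : List Bool := ms.foldl addBlock []

/-- The last number yields the first block of the word, as when the blocks are pushed on a stack one
after the other. -/
theorem blockWord_concat (ms : List ℕ) (m : ℕ) :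
    blockWord (ms ++ [m]) = true :: (List.replicate m false ++ blockWord ms) := by
  simp [blockWord, addBlock]

theorem count_blockWord (ms : List ℕ) : (blockWord ms).count true = ms.length := by
  induction ms using List.reverseRecOn with
  | nil => rfl
  | append_singleton ms m ih =>
    rw [blockWord_concat]
    simp [List.count_replicate, ih]

theorem length_blockWord (ms : List ℕ) : (blockWord ms).length = ms.length + ms.sum := by
  induction ms using List.reverseRecOn with
  | nil => rfl
  | append_singleton ms m ih =>
    rw [blockWord_concat]
    simp [ih]
    omega

/-- Applied to the guard zero, this provides a member besides agent `0`. -/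
theorem exists_pos_of_false_mem (ms : List ℕ) (h : false ∈ blockWord ms) : ∃ m ∈ ms, 0 < m := by
  induction ms using List.reverseRecOn with
  | nil => simp [blockWord] at h
  | append_singleton ms m ih =>
    rw [blockWord_concat] at h
    simp only [List.mem_cons, Bool.false_eq_true, List.mem_append, List.mem_replicate,
      false_or] at h
    rcases h with h | h
    · exact ⟨m, by simp, by omega⟩
    · obtain ⟨m', hm, hp⟩ := ih h
      exact ⟨m', by simp [hm], hp⟩

theorem exists_replicate_false (w : List Bool) :
    ∃ m u, w = List.replicate m false ++ u ∧ (u = [] ∨ ∃ t, u = true :: t) := by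
  induction w with
  | nil => exact ⟨0, [], rfl, .inl rfl⟩
  | cons b w ih =>
    cases b with
    | true => exact ⟨0, true :: w, rfl, .inr ⟨w, rfl⟩⟩
    | false =>
      obtain ⟨m, u, rfl, hu⟩ := ih
      exact ⟨m + 1, u, rfl, hu⟩

/-- A word that starts with a one is determined by the lengths of the gaps after its ones: peel off
the first one and the zeros behind it. The length bound ensures that the gaps fit into the colour
classes. -/
theorem exists_blockWord (l : ℕ) (w : List Bool) (hl : w.count true = l)
    (hw : w = [] ∨ ∃ t, w = true :: t) :
    ∃ ms : List ℕ, ms.length = l ∧ blockWord ms = w ∧ ∀ m ∈ ms, m < w.length := by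
  induction l generalizing w with
  | zero =>
    rcases hw with rfl | ⟨t, rfl⟩
    · exact ⟨[], rfl, rfl, by simp⟩
    · simp at hl
  | succ l ih =>
    rcases hw with rfl | ⟨t, rfl⟩
    · simp at hl
    · obtain ⟨m, u, rfl, hu⟩ := exists_replicate_false t
      obtain ⟨ms, h1, h2, h3⟩ := ih u (by simpa [List.count_replicate] using hl) hu
      refine ⟨ms ++ [m], by simp [h1], by rw [blockWord_concat, h2], ?_⟩
      intro m' hm'
      rcases List.mem_append.mp hm' with h | h
      · have := h3 m' h
        simp
        omega
      · obtain rfl : m' = m := by simpa using h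
        simp

/-- The number of agents of a game with `k + 1` blocks of `N` agents and an additional agent. -/
abbrev agentCount (N k : ℕ) : ℕ := (k + 1) * N + 1

/-- The `j`-th agent of the block `c`. -/
def agentAt {N k : ℕ} (c : Fin (k + 1)) (j : Fin N) : Fin (agentCount N k) :=
  Fin.succ ⟨c * N + j, by
    calc (c : ℕ) * N + j < (c + 1) * N := by rw [Nat.add_mul, Nat.one_mul]; omega
      _ ≤ (k + 1) * N := Nat.mul_le_mul_right _ c.2⟩

/-- The additional agent has colour `0`, the agents of the block `c` have colour `c + 1`. -/
def blockColor {N k : ℕ} (hN : 0 < N) (i : Fin (agentCount N k)) : Fin (k + 2) :=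
  -- This is `i / N` rounded up: agent `c * N + j + 1` gets colour `c + 1`, and only agent `0` gets
  -- colour `0`.
  ⟨(i + (N - 1)) / N, by
    rw [Nat.div_lt_iff_lt_mul hN, show (k + 2) * N = (k + 1) * N + N by ring]
    have := i.2
    simp only [agentCount] at this
    omega⟩

/-! ### Agents in colour blocks, palettes and the utility of agent `0` -/

section

variable {N k : ℕ} (hN : 0 < N)

theorem agentAt_ne_zero (c : Fin (k + 1)) (j : Fin N) : agentAt c j ≠ 0 := Fin.succ_ne_zero _

theorem blockColor_zero : blockColor (k := k) hN 0 = 0 := by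
  ext
  simp only [blockColor, Fin.val_zero]
  exact Nat.div_eq_of_lt (by omega)

theorem blockColor_agentAt (c : Fin (k + 1)) (j : Fin N) :
    blockColor hN (agentAt c j) = c.succ := by
  ext
  simp only [blockColor, agentAt, Fin.val_succ]
  rw [show (c : ℕ) * N + j + 1 + (N - 1) = j + (c + 1) * N by rw [Nat.add_mul]; omega,
    Nat.add_mul_div_right _ _ hN, Nat.div_eq_of_lt j.2, zero_add]

theorem agentAt_inj {c c' : Fin (k + 1)} {j j' : Fin N} (h : agentAt c j = agentAt c' j') :
    c = c' ∧ j = j' := by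
  have hN : 0 < N := j.pos
  have hc : c = c' := by
    have := congrArg (blockColor hN) h
    rwa [blockColor_agentAt, blockColor_agentAt, Fin.succ_inj] at this
  subst hc
  refine ⟨rfl, ?_⟩
  have := congrArg Fin.val h
  simp only [agentAt, Fin.val_succ] at this
  ext
  omega

theorem exists_agentAt {N k : ℕ} {i : Fin (agentCount N k)} (hi : i ≠ 0) :
    ∃ c j, i = agentAt (N := N) (k := k) c j := by
  obtain ⟨⟨i, h⟩, rfl⟩ := Fin.exists_succ_eq.mpr hi
  have hN : 0 < N := by
    rcases Nat.eq_zero_or_pos N with rfl | h'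
    · simp at h
    · exact h'
  refine ⟨⟨i / N, (Nat.div_lt_iff_lt_mul hN).mpr h⟩, ⟨i % N, Nat.mod_lt _ hN⟩, ?_⟩
  ext
  simp only [agentAt, Fin.val_succ]
  rw [Nat.div_add_mod']

theorem blockColor_surjective : Function.Surjective (blockColor (k := k) hN) := by
  intro c
  induction c using Fin.cases with
  | zero => exact ⟨0, blockColor_zero hN⟩
  | succ c => exact ⟨agentAt c ⟨0, hN⟩, blockColor_agentAt hN c _⟩

theorem blockColor_eq_zero_iff (i : Fin (agentCount N k)) : blockColor hN i = 0 ↔ i = 0 := by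
  refine ⟨fun h => ?_, fun h => h ▸ blockColor_zero hN⟩
  by_contra hi
  obtain ⟨c, j, rfl⟩ := exists_agentAt hi
  rw [blockColor_agentAt] at h
  exact absurd h (Fin.succ_ne_zero _)

theorem ofFn_agents {α : Type*} (f : Fin (agentCount N k) → α) :
    List.ofFn f = f 0 :: (List.ofFn fun c => List.ofFn fun j => f (agentAt c j)).flatten := by
  rw [List.ofFn_succ, List.ofFn_mul]
  rfl

/-- The characteristic vector of a coalition on a block. -/
def blockBits (X : Finset (Fin (agentCount N k))) (c : Fin (k + 1)) : List Bool :=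
  List.ofFn fun j => decide (agentAt c j ∈ X)

@[simp] theorem length_blockBits (X : Finset (Fin (agentCount N k))) (c : Fin (k + 1)) :
    (blockBits X c).length = N := by
  simp [blockBits]

theorem ofFn_mem (X : Finset (Fin (agentCount N k))) :
    (List.ofFn fun a => decide (a ∈ X)) =
      decide (0 ∈ X) :: (List.ofFn (blockBits X)).flatten := by
  rw [ofFn_agents]
  rfl

/-- The number of members of a coalition in every block. -/
def blockCounts (X : Finset (Fin (agentCount N k))) : List ℕ :=
  List.ofFn fun c => (blockBits X c).count true

/-- The word of a coalition. -/
def coalitionWord (X : Finset (Fin (agentCount N k))) : List Bool := blockWord (blockCounts X)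

theorem count_blockBits (X : Finset (Fin (agentCount N k))) (c : Fin (k + 1)) :
    (blockBits X c).count true = (X.filter fun i => blockColor hN i = c.succ).card := by
  rw [blockBits, List.count_true_ofFn]
  refine Finset.card_bij (fun j _ => agentAt c j) ?_ ?_ ?_
  · intro j hj
    simpa [blockColor_agentAt] using hj
  · intro j _ j' _ h
    exact (agentAt_inj h).2
  · intro i hi
    rw [Finset.mem_filter] at hi
    have h0 : i ≠ 0 := by
      rintro rfl
      rw [blockColor_zero] at hi
      exact absurd hi.2 (Fin.succ_ne_zero _).symm
    obtain ⟨c', j, rfl⟩ := exists_agentAt h0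
    rw [blockColor_agentAt, Fin.succ_inj] at hi
    obtain ⟨hi, rfl⟩ := hi
    exact ⟨j, by simpa using hi, rfl⟩

/-- Agent `0` is the only agent of its colour, so this entry shows whether it belongs to the
coalition and, if so, how large the coalition is. -/
theorem palette_zero (X : Finset (Fin (agentCount N k))) :
    palette (blockColor hN) X 0 = if 0 ∈ X then (X.card : ℚ)⁻¹ else 0 := by
  unfold palette
  split_ifs with h
  · have : (X.filter fun a => blockColor hN a = 0) = {0} := by
      ext i
      simp only [Finset.mem_filter, blockColor_eq_zero_iff, Finset.mem_singleton]
      exact ⟨fun h => h.2, fun h' => ⟨h' ▸ h, h'⟩⟩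
    rw [this]
    simp
  · have : (X.filter fun a => blockColor hN a = 0) = ∅ := by
      ext i
      simp only [Finset.mem_filter, blockColor_eq_zero_iff, Finset.notMem_empty, iff_false]
      rintro ⟨h1, rfl⟩
      exact h h1
    rw [this]
    simp

open Classical in
/-- The utility of a coalition for the agent `0`: being alone is better than a coalition whose word
is not acceptable, and worse than a coalition whose word is acceptable. -/
noncomputable def utility (Acc : List Bool → Prop) (X : Finset (Fin (agentCount N k))) : ℕ :=
  if 0 ∈ X then if X.card = 1 then 1 else if Acc (coalitionWord X) then 2 else 0 else 0

theorem utility_le (Acc : List Bool → Prop) (X : Finset (Fin (agentCount N k))) :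
    utility Acc X ≤ 2 := by
  unfold utility
  split_ifs <;> omega

/-- This makes the utility a function of the palette. Coalitions without agent `0` all have utility
`0`; for the others the entry of colour `0` gives the size, and multiplying by it recovers the
numbers of members of each colour. -/
theorem utility_eq_of_palette_eq (Acc : List Bool → Prop) {X Y : Finset (Fin (agentCount N k))}
    (hX : X.Nonempty) (hY : Y.Nonempty)
    (h : palette (blockColor hN) X = palette (blockColor hN) Y) :
    utility Acc X = utility Acc Y := by
  have hX' : (X.card : ℚ) ≠ 0 := by exact_mod_cast hX.card_pos.ne'
  have hY' : (Y.card : ℚ) ≠ 0 := by exact_mod_cast hY.card_pos.ne'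
  have h0 := congrFun h 0
  rw [palette_zero, palette_zero] at h0
  by_cases hx : 0 ∈ X
  · by_cases hy : 0 ∈ Y
    · rw [if_pos hx, if_pos hy, inv_inj] at h0
      have hw : coalitionWord X = coalitionWord Y := by
        unfold coalitionWord blockCounts
        congr 2
        funext c
        have hc := congrFun h c.succ
        unfold palette at hc
        rw [h0, div_left_inj' hY'] at hc
        rw [count_blockBits hN, count_blockBits hN]
        exact_mod_cast hc
      have hcard : X.card = Y.card := by exact_mod_cast h0
      unfold utility
      rw [if_pos hx, if_pos hy, hw, hcard]
    · rw [if_pos hx, if_neg hy] at h0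
      exact absurd h0 (inv_ne_zero hX')
  · by_cases hy : 0 ∈ Y
    · rw [if_neg hx, if_pos hy] at h0
      exact absurd h0.symm (inv_ne_zero hY')
    · simp [utility, hx, hy]

/-- The utility of a palette for the agent `0`. -/
noncomputable def paletteUtility (Acc : List Bool → Prop) (p : Palette (blockColor (k := k) hN)) :
    ℕ := utility Acc p.2.choose

theorem paletteUtility_of (Acc : List Bool → Prop) (X : Finset (Fin (agentCount N k)))
    (hX : X.Nonempty) : paletteUtility hN Acc (Palette.of _ X hX) = utility Acc X :=
  utility_eq_of_palette_eq hN Acc (Palette.of (blockColor hN) X hX).2.choose_spec.1 hX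
    (Palette.of (blockColor hN) X hX).2.choose_spec.2

/-- The game in which the agent `0` looks for a coalition with an acceptable word, and all other
agents are indifferent. -/
noncomputable def wordGame (k : ℕ) (Acc : List Bool → Prop) : Instance where
  n := agentCount N k
  n_pos := Nat.succ_pos _
  γ := k + 2
  color := blockColor hN
  color_surjective := blockColor_surjective hN
  -- The premise is false for every other agent, which is therefore indifferent.
  pref i p q := i = (0 : Fin (agentCount N k)) → paletteUtility hN Acc q ≤ paletteUtility hN Acc p
  pref_total _ p q := (le_total (paletteUtility hN Acc q) (paletteUtility hN Acc p)).imp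
    (fun h _ => h) (fun h _ => h)
  pref_trans _ _ _ _ h1 h2 hi := (h2 hi).trans (h1 hi)
  -- One less than the number of agents other than `0`: they do not fit into one coalition.
  maxSize := (k + 1) * N - 1
  maxCoalitions := 2
  maxNontrivial := 2

/-! ### Preferences and agent types of the game -/

variable (Acc : List Bool → Prop)

theorem weakPref_wordGame_iff (i : Fin (agentCount N k)) (X Y : Finset (Fin (agentCount N k)))
    (hX : X.Nonempty) (hY : Y.Nonempty) :
    (wordGame hN k Acc).WeakPref i X Y ↔ (i = 0 → utility Acc Y ≤ utility Acc X) := by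
  have e : (∀ hX hY, (i = 0 → paletteUtility hN Acc (Palette.of _ Y hY) ≤
      paletteUtility hN Acc (Palette.of _ X hX)) ↔ (i = 0 → utility Acc Y ≤ utility Acc X)) := by
    intro hX hY
    rw [paletteUtility_of, paletteUtility_of]
  constructor
  · rintro ⟨hX, hY, h⟩
    exact (e hX hY).mp h
  · intro h
    exact ⟨hX, hY, (e hX hY).mpr h⟩

theorem utility_singleton : utility Acc ({0} : Finset (Fin (agentCount N k))) = 1 := by
  simp [utility]

theorem numTypes_wordGame : (wordGame hN k Acc).numTypes = 2 := by
  have hpos : 0 < (k + 1) * N := Nat.mul_pos (Nat.succ_pos _) hN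
  let P : Palette (blockColor (k := k) hN) → Palette (blockColor (k := k) hN) → Prop :=
    fun p q => paletteUtility hN Acc q ≤ paletteUtility hN Acc p
  have hrange : Set.range (wordGame hN k Acc).pref =
      ({P, fun _ _ => True} : Set (Palette (blockColor (k := k) hN) → _ → Prop)) := by
    ext R
    constructor
    · rintro ⟨i, rfl⟩
      by_cases hi : i = (0 : Fin (agentCount N k))
      · refine Set.mem_insert_iff.mpr (.inl ?_)
        funext p q
        exact propext ⟨fun h => h hi, fun h _ => h⟩
      · refine Set.mem_insert_iff.mpr (.inr ?_)
        funext p q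
        exact eq_true fun h => absurd h hi
    · rintro (rfl | rfl)
      · refine ⟨(0 : Fin (agentCount N k)), ?_⟩
        funext p q
        exact propext ⟨fun h => h rfl, fun h _ => h⟩
      · refine ⟨(Fin.succ ⟨0, hpos⟩ : Fin (agentCount N k)), ?_⟩
        funext p q
        exact eq_true fun h => absurd h (Fin.succ_ne_zero _)
  refine (congrArg Set.ncard hrange).trans (Set.ncard_pair ?_)
  intro h
  -- Agent `0` is not indifferent: alone it has utility `1`, in the grand coalition `0` or `2`.
  let p := Palette.of (blockColor (k := k) hN) {0} (Finset.singleton_nonempty _)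
  let q := Palette.of (blockColor (k := k) hN) Finset.univ Finset.univ_nonempty
  have h1 : P p q := by rw [h]; trivial
  have h2 : P q p := by rw [h]; trivial
  have h3 := le_antisymm h1 h2
  simp only [p, q, paletteUtility_of, utility_singleton] at h3
  unfold utility at h3
  rw [if_pos (Finset.mem_univ _), if_neg] at h3
  · split_ifs at h3
    all_goals simp at h3
  · rw [Finset.card_univ, Fintype.card_fin]
    simp only [agentCount]
    omega

/-! ### Stable outcomes -/

/-- The coalition of agent `0` is the witness: the bounds exclude that it is a singleton, and
stability excludes that it is worse than a singleton. -/
theorem exists_coalition_of_individuallyStable 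
    (P : Finpartition (Finset.univ : Finset (Fin (agentCount N k))))
    (hP : Instance.Admissible (G := wordGame hN k Acc) P)
    (hs : Instance.IndividuallyStable (G := wordGame hN k Acc) P) :
    ∃ X : Finset (Fin (agentCount N k)), Acc (coalitionWord X) := by
  have hpos : 0 < (k + 1) * N := Nat.mul_pos (Nat.succ_pos _) hN
  let z : Fin (agentCount N k) := 0
  have hz : z ∈ P.part z := P.mem_part (Finset.mem_univ z)
  have hmem : P.part z ∈ P.parts := P.part_mem.mpr (Finset.mem_univ z)
  refine ⟨P.part z, ?_⟩
  by_contra hacc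
  by_cases hcard : (P.part z).card = 1
  -- All agents other than `0` would lie in at most one coalition, against the size bound.
  · have hsum := P.sum_card_parts
    rw [← Finset.add_sum_erase _ _ hmem, hcard] at hsum
    have hle : ∑ C ∈ P.parts.erase (P.part z), C.card ≤
        (P.parts.erase (P.part z)).card * ((k + 1) * N - 1) := by
      rw [← smul_eq_mul]
      exact Finset.sum_le_card_nsmul _ _ _ fun C hC => hP.2.2 C (Finset.mem_of_mem_erase hC)
    have hc : (P.parts.erase (P.part z)).card ≤ 1 := by
      rw [Finset.card_erase_of_mem hmem]
      have : P.parts.card ≤ 2 := hP.1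
      omega
    have := hle.trans (Nat.mul_le_mul_right _ hc)
    rw [Finset.card_univ, Fintype.card_fin] at hsum
    change _ = (k + 1) * N + 1 at hsum
    omega
  · have hu : utility Acc (P.part z) = 0 := by
      unfold utility
      rw [if_pos hz, if_neg hcard, if_neg hacc]
    have hne : (P.part z).Nonempty := ⟨z, hz⟩
    -- Leaving for the empty coalition raises the utility from `0` to `1`; the consent condition is
    -- vacuous.
    refine hs z ∅ ⟨⟨.inr rfl, ?_, ?_⟩, by simp⟩
    · refine (weakPref_wordGame_iff hN Acc _ _ _ (Finset.insert_nonempty _ _) hne).mpr ?_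
      intro _
      rw [hu]
      exact Nat.zero_le _
    · intro h
      have := (weakPref_wordGame_iff hN Acc _ _ _ hne (Finset.insert_nonempty _ _)).mp h rfl
      rw [hu] at this
      have h1 : utility Acc (insert z ∅ : Finset (Fin (agentCount N k))) = 1 := by
        rw [insert_empty_eq]
        exact utility_singleton Acc
      exact absurd (h1.ge.trans this) (by omega)

theorem exists_nashStable (X : Finset (Fin (agentCount N k))) (h0 : 0 ∈ X) (h2 : 2 ≤ X.card)
    (h2' : 2 ≤ Xᶜ.card) (h : Acc (coalitionWord X)) :
    ∃ P : (wordGame hN k Acc).Outcome, Instance.Admissible P ∧ Instance.NashStable P := by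
  have hXc : Xᶜ ≠ ⊥ := by
    rintro h
    simp [h] at h2'
  have hX : X ≠ ⊥ := by
    rintro h
    simp [h] at h2
  let P : Finpartition (Finset.univ : Finset (Fin (agentCount N k))) :=
    (Finpartition.indiscrete hXc).extend hX disjoint_compl_left
      (by rw [sup_comm]; exact sup_compl_eq_top)
  have hparts : P.parts = {X, Xᶜ} := rfl
  have hpart : P.part 0 = X := P.part_eq_of_mem (by simp [hparts]) h0
  refine ⟨P, ⟨?_, ?_, ?_⟩, ?_⟩
  · change P.parts.card ≤ 2
    rw [hparts]
    exact Finset.card_le_two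
  · refine (Finset.card_filter_le _ _).trans ?_
    change P.parts.card ≤ 2
    rw [hparts]
    exact Finset.card_le_two
  -- There are `(k + 1) * N + 1` agents and both parts have at least two, so neither exceeds the
  -- size bound.
  · suffices ∀ C : Finset (Fin (agentCount N k)), C ∈ P.parts → C.card ≤ (k + 1) * N - 1 from this
    intro C hC
    have hsum := Finset.card_add_card_compl X
    rw [Fintype.card_fin] at hsum
    change _ = (k + 1) * N + 1 at hsum
    rw [hparts, Finset.mem_insert, Finset.mem_singleton] at hC
    rcases hC with rfl | rfl <;> omega
  · rintro i C ⟨-, ⟨⟨_, hne, -⟩, h'⟩⟩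
    apply h'
    refine (weakPref_wordGame_iff hN Acc _ _ _ hne (Finset.insert_nonempty _ _)).mpr ?_
    intro hi
    have hi' : i = (0 : Fin (agentCount N k)) := hi
    subst hi'
    have : utility Acc (P.part 0) = 2 := by
      rw [hpart]
      unfold utility
      rw [if_pos h0, if_neg (by omega), if_pos h]
    -- Agent `0` already has the largest possible utility.
    exact (utility_le Acc (insert (0 : Fin (agentCount N k)) C)).trans this.ge

/-! ### The game of a formula -/

theorem count_coalitionWord (X : Finset (Fin (agentCount N k))) :
    (coalitionWord X).count true = k + 1 := by
  rw [coalitionWord, count_blockWord, blockCounts, List.length_ofFn]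

theorem coalitionWord_eq_cons (X : Finset (Fin (agentCount N k))) :
    ∃ w, coalitionWord X = true :: w := by
  unfold coalitionWord blockCounts
  rw [List.ofFn_succ', List.concat_eq_append, blockWord_concat]
  exact ⟨_, rfl⟩

/-- Take agent `0` and the first `f c` agents of each block `c`. The two spare agents per block keep
the complement large enough for the size bound. -/
theorem exists_coalition (ms : List ℕ) (hl : ms.length = k + 1) (hms : ∀ m ∈ ms, m + 2 ≤ N)
    (hpos : ∃ m ∈ ms, 0 < m) :
    ∃ X : Finset (Fin (agentCount N k)), 0 ∈ X ∧ 2 ≤ X.card ∧ 2 ≤ Xᶜ.card ∧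
      coalitionWord X = blockWord ms := by
  obtain ⟨f, rfl⟩ : ∃ f : Fin (k + 1) → ℕ, ms = List.ofFn f := by
    refine ⟨fun c => ms[c], ?_⟩
    have := (List.ofFn_getElem (xs := ms)).symm
    rwa [List.ofFn_congr hl] at this
  have hf : ∀ c, f c + 2 ≤ N := fun c => hms _ (List.mem_ofFn.mpr ⟨c, rfl⟩)
  classical
  let X : Finset (Fin (agentCount N k)) := Finset.univ.filter fun i =>
    ∀ (c : Fin (k + 1)) (j : Fin N), i = agentAt c j → (j : ℕ) < f c
  have h0 : 0 ∈ X := by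
    simp only [X, Finset.mem_filter, Finset.mem_univ, true_and]
    intro c j h
    exact absurd h.symm (agentAt_ne_zero c j)
  have hX : ∀ c j, agentAt c j ∈ X ↔ (j : ℕ) < f c := by
    intro c j
    simp only [X, Finset.mem_filter, Finset.mem_univ, true_and]
    refine ⟨fun h => h c j rfl, fun h c' j' e => ?_⟩
    obtain ⟨rfl, rfl⟩ := agentAt_inj e
    exact h
  refine ⟨X, h0, ?_, ?_, ?_⟩
  · obtain ⟨m, hm, hm0⟩ := hpos
    obtain ⟨c, rfl⟩ := List.mem_ofFn.mp hm
    have : 0 < N := by have := hf c; omega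
    rw [← Finset.card_pair (agentAt_ne_zero c (⟨0, this⟩ : Fin N)).symm]
    refine Finset.card_le_card ?_
    intro i hi
    rw [Finset.mem_insert, Finset.mem_singleton] at hi
    rcases hi with rfl | rfl
    · exact h0
    · exact (hX _ _).mpr hm0
  · have h0N := hf 0
    -- The last two agents of block `0` are outside `X`.
    have hne : agentAt (0 : Fin (k + 1)) (⟨N - 2, by omega⟩ : Fin N) ≠
        agentAt (0 : Fin (k + 1)) (⟨N - 1, by omega⟩ : Fin N) := by
      intro h
      have := congrArg Fin.val (agentAt_inj h).2
      simp only at this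
      omega
    rw [← Finset.card_pair hne]
    refine Finset.card_le_card ?_
    intro i hi
    rw [Finset.mem_insert, Finset.mem_singleton] at hi
    rw [Finset.mem_compl]
    rcases hi with rfl | rfl <;> rw [hX] <;> simp only <;> omega
  · unfold coalitionWord blockCounts
    congr 2
    funext c
    rw [blockBits, List.count_true_ofFn]
    simp only [hX, decide_eq_true_eq]
    have := hf c
    rw [Fin.card_filter_val_lt]
    omega

/-- One of the `k + 1` ones is the leading symbol, so the assignment has weight `k`. -/
theorem mem_of_accepts (x : List Bool) {k : ℕ} (X : Finset (Fin (agentCount N k)))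
    (h : Accepts x (coalitionWord X)) : (x, k) ∈ weightedTwoCNFSat := by
  obtain ⟨φ, hx, a, ha, hw⟩ := h.exists_satisfied
  refine ⟨φ, hx, a, ha, ?_⟩
  obtain ⟨w, hw'⟩ := coalitionWord_eq_cons X
  have hc := count_coalitionWord X
  rw [hw'] at hw hc
  rw [List.tail_cons] at hw
  rw [hw, List.count_cons_self, List.count_cons_of_ne (by simp), List.count_true_ofFn] at hc
  simpa using hc

theorem exists_accepts (x : List Bool) (k : ℕ) (h : (x, k) ∈ weightedTwoCNFSat) :
    ∃ X : Finset (Fin (agentCount (x.length + 2) k)), 0 ∈ X ∧ 2 ≤ X.card ∧ 2 ≤ Xᶜ.card ∧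
      Accepts x (coalitionWord X) := by
  obtain ⟨φ, hx, a, ha, hk⟩ := h
  simp only at hx hk
  have hcount : (true :: false :: List.ofFn a).count true = k + 1 := by
    rw [List.count_cons_self, List.count_cons_of_ne (by simp), List.count_true_ofFn, hk]
  obtain ⟨ms, hl, hw, hlt⟩ := exists_blockWord (k + 1) _ hcount (.inr ⟨_, rfl⟩)
  -- The header alone has `numVars + 1` symbols. A gap in a word of length `numVars + 2` is at most
  -- `numVars + 1`, so `N = |x| + 2` leaves two spare agents in each block.
  have hlen : φ.numVars + 1 ≤ x.length := by
    rw [hx]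
    simp [TwoCNF.encode, encNat, Machine.unary]
  obtain ⟨X, h0, h2, h2', hX⟩ := exists_coalition (N := x.length + 2) (k := k) ms hl
    (fun m hm => by
      have := hlt m hm
      simp at this
      omega)
    (exists_pos_of_false_mem ms (by rw [hw]; simp))
  refine ⟨X, h0, h2, h2', ?_⟩
  rw [hX, hw, hx]
  exact accepts_ofFn φ a ha true

end

/-- The game of the weighted satisfiability instance `(x, k)`. -/
noncomputable def formulaGame (x : List Bool) (k : ℕ) : Instance :=
  wordGame (N := x.length + 2) (Nat.succ_pos _) k (Accepts x)

theorem formulaGame_yes_iff {stable : ∀ G : Instance, G.Outcome → Prop}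
    (h1 : ∀ G P, Instance.NashStable P → stable G P)
    (h2 : ∀ G P, stable G P → Instance.IndividuallyStable P) (x : List Bool) (k : ℕ) :
    (x, k) ∈ weightedTwoCNFSat ↔ formulaGame x k ∈ (problem stable).yes := by
  constructor
  · intro h
    obtain ⟨X, h0, h2, h2', h⟩ := exists_accepts x k h
    obtain ⟨P, hP, hs⟩ := exists_nashStable (Nat.succ_pos _) (Accepts x) X h0 h2 h2' h
    exact ⟨P, hP, h1 _ _ hs⟩
  · rintro ⟨P, hP, hs⟩
    obtain ⟨X, hX⟩ := exists_coalition_of_individuallyStable _ _ P hP (h2 _ _ hs)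
    exact mem_of_accepts x X hX

/-! ### The words of the input and of the queries -/

theorem encode_wordGame {N k : ℕ} (hN : 0 < N) (Acc : List Bool → Prop) :
    (wordGame hN k Acc).encode =
      encNat (k + 2) ++ encNat ((k + 1) * N - 1) ++ encNat 2 ++ encNat 2 ++ (encNat 0 ++
        (List.ofFn fun c : Fin (k + 1) =>
          (List.replicate N (encNat (c + 1))).flatten).flatten) := by
  unfold Instance.encode
  congr 1
  change (List.ofFn fun i : Fin (agentCount N k) => encNat (blockColor hN i)).flatten = _
  rw [ofFn_agents, List.flatten_cons, blockColor_zero]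
  congr 1
  simp only [blockColor_agentAt, Fin.val_succ, List.ofFn_const]
  rw [List.flatten_flatten, List.map_ofFn]
  rfl

theorem encodeQuery_wordGame {N k : ℕ} (hN : 0 < N) (Acc : List Bool → Prop)
    (q : (wordGame hN k Acc).Query) :
    ∃ X Y : Finset (Fin (agentCount N k)), ∃ i : Fin (agentCount N k),
      (wordGame hN k Acc).encodeQuery q = encNat i ++
        (decide (0 ∈ X) :: (List.ofFn (blockBits X)).flatten) ++
        (decide (0 ∈ Y) :: (List.ofFn (blockBits Y)).flatten) ∧
      ((wordGame hN k Acc).WeakPref q.agent q.left q.right ↔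
        (i = 0 → utility Acc Y ≤ utility Acc X)) := by
  refine ⟨q.left, q.right, q.agent, ?_,
    weakPref_wordGame_iff hN Acc _ _ _ q.left_nonempty q.right_nonempty⟩
  exact congrArg₂ (fun u v => encNat q.agent ++ u ++ v)
    (ofFn_mem (N := N) (k := k) q.left) (ofFn_mem (N := N) (k := k) q.right)

end HDG

namespace Machine

@[simp] theorem length_unary (m : ℕ) : (unary m).length = m := List.length_replicate

theorem unary_append_cons (m : ℕ) (w : List Bool) : unary m ++ true :: w = unary (m + 1) ++ w := by
  rw [unary, unary, List.replicate_succ', List.append_assoc]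
  rfl

end Machine

namespace HDG

open Machine ParamComplexity

/-! ### Writing the explicit part of the game of a formula -/

/-- Push the code of the number on stack `1` on stack `0`, using stack `3`. -/
def emitNumber : Prog :=
  .seq (.push 0 false)
    (.seq (.loop 1 (.seq (.pop 1) (.seq (.push 3 true) (.push 0 true)))) (drain 3 1))

/-- The output `o` and the counter `d` are arbitrary because the induction changes both. -/
theorem runs_emitNumber_loop (R : Regs) (hi : Store) (o : List Bool) (c d : ℕ) :
    Runs (.loop 1 (.seq (.pop 1) (.seq (.push 3 true) (.push 0 true))))
      (Regs.store { R with r0 := o, r1 := unary c, r3 := unary d } hi)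
      (Regs.store { R with r0 := unary c ++ o, r1 := [], r3 := unary (c + d) } hi) (4 * c + 1) := by
  induction c generalizing o d with
  | zero => exact (Runs.loopNil rfl).congr (by rw [Nat.zero_add]; rfl)
  | succ c ih =>
    refine ((Runs.loopCons rfl ((Runs.popR _ hi 1).seq ((Runs.pushR _ hi 3 true).seq
      (Runs.pushR _ hi 0 true))) (ih (true :: o) (d + 1))).mono (by omega)).congr ?_
    rw [unary_append_cons, add_right_comm c 1 d, add_assoc c d 1]

theorem runs_emitNumber (R : Regs) (hi : Store) (o : List Bool) (c : ℕ) :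
    Runs emitNumber (Regs.store { R with r0 := o, r1 := unary c, r3 := [] } hi)
      (Regs.store { R with r0 := encNat c ++ o, r1 := unary c, r3 := [] } hi) (7 * c + 3) := by
  have h1 := runs_emitNumber_loop R hi (false :: o) c 0
  have h2 := (Runs.pushR { R with r0 := o, r1 := unary c, r3 := [] } hi 0 false).seq
    (h1.seq (Runs.drainR _ hi 3 1))
  refine (h2.mono ?_).congr ?_
  · simp [Regs.get]
    omega
  · simp [Regs.get, Regs.set, encNat]

/-- Push the codes of the colours of a block of agents on stack `0`; the colour is on stack `1`, the
length of the block on stack `5`, and the agents are counted on stack `4`. -/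
def emitBlock : Prog :=
  .seq (.loop 5 (.seq emitNumber (.seq (.push 4 true) (.seq (.pop 5) (.push 2 true)))))
    (drain 2 5)

theorem runs_emitBlock_loop (R : Regs) (hi : Store) (o : List Bool) (c a m e : ℕ) :
    Runs (.loop 5 (.seq emitNumber (.seq (.push 4 true) (.seq (.pop 5) (.push 2 true)))))
      (Regs.store { R with
        r0 := o, r1 := unary c, r2 := unary e, r3 := [], r4 := unary a, r5 := unary m } hi)
      (Regs.store { R with
        r0 := (List.replicate m (encNat c)).flatten ++ o, r1 := unary c, r2 := unary (m + e),
        r3 := [], r4 := unary (m + a), r5 := [] } hi) (m * (7 * c + 7) + 1) := by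
  induction m generalizing o e a with
  | zero =>
    refine Runs.congr (Runs.mono (Runs.loopNil rfl) (Nat.le_add_left _ _)) ?_
    rw [Nat.zero_add, Nat.zero_add]
    rfl
  | succ m ih =>
    have h1 := runs_emitNumber { R with r2 := unary e, r4 := unary a, r5 := unary (m + 1) } hi o c
    refine ((Runs.loopCons rfl (h1.seq ((Runs.pushR _ hi 4 true).seq ((Runs.popR _ hi 5).seq
      (Runs.pushR _ hi 2 true)))) (ih (encNat c ++ o) (a + 1) (e + 1))).mono ?_).congr ?_
    · rw [Nat.add_mul m 1]
      omega
    · rw [add_right_comm m 1 e, add_right_comm m 1 a, add_assoc m e 1, add_assoc m a 1,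
        List.replicate_succ', List.flatten_append]
      simp

theorem runs_emitBlock (R : Regs) (hi : Store) (o : List Bool) (c a N : ℕ) :
    Runs emitBlock
      (Regs.store { R with
        r0 := o, r1 := unary c, r2 := [], r3 := [], r4 := unary a, r5 := unary N } hi)
      (Regs.store { R with
        r0 := (List.replicate N (encNat c)).flatten ++ o, r1 := unary c, r2 := [],
        r3 := [], r4 := unary (N + a), r5 := unary N } hi) (N * (7 * c + 10) + 2) := by
  have h1 := runs_emitBlock_loop R hi o c a N 0
  refine ((h1.seq (Runs.drainR _ hi 2 5)).mono ?_).congr ?_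
  · simp only [Regs.get, length_unary]
    ring_nf
    omega
  · simp [Regs.get, Regs.set]

/-- Push the codes of the colours of all blocks; the number of blocks is on stack `1`, and is moved
to stack `6`. -/
def emitBlocks : Prog := .loop 1 (.seq emitBlock (.seq (.pop 1) (.push 6 true)))

/-- The output stack grows at its front, so the blocks are written from last to first. The number of
blocks still to be written is then the colour of the next one. `K` bounds all colours, for a uniform
running time. -/
theorem runs_emitBlocks (R : Regs) (hi : Store) (o : List Bool) (a N e K c : ℕ) (hc : c ≤ K) :
    Runs emitBlocks
      (Regs.store { R with
        r0 := o, r1 := unary c, r2 := [], r3 := [], r4 := unary a, r5 := unary N,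
        r6 := unary e } hi)
      (Regs.store { R with
        r0 := (List.ofFn fun i : Fin c => (List.replicate N (encNat (i + 1))).flatten).flatten ++ o,
        r1 := [], r2 := [], r3 := [], r4 := unary (c * N + a), r5 := unary N,
        r6 := unary (c + e) } hi) (c * (N * (7 * K + 10) + 5) + 1) := by
  induction c generalizing o a e with
  | zero =>
    refine Runs.congr (Runs.mono (Runs.loopNil rfl) (Nat.le_add_left _ _)) ?_
    rw [Nat.zero_mul, Nat.zero_add, Nat.zero_add]
    rfl
  | succ c ih =>
    have h1 := runs_emitBlock { R with r6 := unary e } hi o (c + 1) a N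
    have h2 := ih ((List.replicate N (encNat (c + 1))).flatten ++ o) (N + a) (e + 1) (by omega)
    refine ((Runs.loopCons rfl (h1.seq ((Runs.popR _ hi 1).seq (Runs.pushR _ hi 6 true)))
      h2).mono ?_).congr ?_
    · have : N * (7 * (c + 1) + 10) ≤ N * (7 * K + 10) := Nat.mul_le_mul_left _ (by omega)
      rw [Nat.add_mul c 1]
      omega
    · rw [List.ofFn_succ', List.concat_eq_append, List.flatten_append,
        show c + 1 + e = c + (e + 1) by omega, show (c + 1) * N + a = c * N + (N + a) by ring]
      simp

/-- From `x` on stack `0` and `k` on stack `1`, compute the explicit part of the game of `(x, k)` on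
stack `0` and its parameter on stack `1`. -/
def inputProg : Prog :=
  .seq (drain 0 5) <| .seq (.push 5 true) <| .seq (.push 5 true) <| .seq (.push 1 true) <|
  .seq emitBlocks <| .seq (.push 0 false) <|
  .seq (.push 0 false) <| .seq (.push 0 true) <| .seq (.push 0 true) <|
  .seq (.push 0 false) <| .seq (.push 0 true) <| .seq (.push 0 true) <|
  .seq (.pop 4) <| .seq (.push 0 false) <| .seq (drain 4 0) <|
  .seq (.push 6 true) <| .seq (.push 0 false) <|
  .seq (.loop 6 (.seq (.pop 6) (.seq (.push 0 true) (.push 1 true)))) <|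
  .seq (.push 1 true) <| .seq (.push 1 true) <| .seq (.push 1 true) (.push 1 true)

theorem runs_inputProg_loop (R : Regs) (hi : Store) (o : List Bool) (c d : ℕ) :
    Runs (.loop 6 (.seq (.pop 6) (.seq (.push 0 true) (.push 1 true))))
      (Regs.store { R with r0 := o, r1 := unary d, r6 := unary c } hi)
      (Regs.store { R with r0 := unary c ++ o, r1 := unary (c + d), r6 := [] } hi) (4 * c + 1) := by
  induction c generalizing o d with
  | zero => exact (Runs.loopNil rfl).congr (by rw [Nat.zero_add]; rfl)
  | succ c ih =>
    refine ((Runs.loopCons rfl ((Runs.popR _ hi 6).seq ((Runs.pushR _ hi 0 true).seq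
      (Runs.pushR _ hi 1 true))) (ih (true :: o) (d + 1))).mono (by omega)).congr ?_
    rw [unary_append_cons, add_right_comm c 1 d, add_assoc c d 1]

/-- The input is written from back to front. The count of agents on stack `4`, reduced by one, is
the size bound; the number of colours `k + 2` is copied to stack `1`, and four more ones account for
the two coalitions and the two types. -/
theorem runs_inputProg (x : List Bool) (k : ℕ) (hi : Store) :
    ∃ R : Regs, R.r0 = (formulaGame x k).encode ∧ R.r1 = unary (k + 6) ∧
      Runs inputProg (Regs.store { r0 := x, r1 := unary k } hi) (R.store hi)
        (100 * (x.length + k + 1) ^ 3) := by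
  obtain ⟨M, hM⟩ : ∃ M, (k + 1) * (x.length + 2) = M + 1 :=
    Nat.exists_eq_succ_of_ne_zero (Nat.mul_pos (Nat.succ_pos _) (Nat.succ_pos _)).ne'
  have h1 := runs_emitBlocks {} hi [] 0 (x.length + 2) 0 (k + 1) (k + 1) le_rfl
  have e0 : unary (x.length + 2) = true :: true :: (unary x.length ++ []) := by
    rw [List.append_nil]; rfl
  rw [e0, hM] at h1
  obtain ⟨o, ho⟩ : ∃ o, o = (List.ofFn fun i : Fin (k + 1) =>
    (List.replicate (x.length + 2) (encNat (i + 1))).flatten).flatten ++ [] := ⟨_, rfl⟩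
  rw [← ho] at h1
  have h2 : Runs (drain 4 0) _ (Regs.store
    { r0 := unary M ++ false :: (encNat 2 ++ (encNat 2 ++ (encNat 0 ++ o))),
      r5 := true :: true :: (unary x.length ++ []), r6 := unary (k + 1) } hi) (3 * M + 1) :=
    ((Runs.drainR
      { r0 := false :: (encNat 2 ++ (encNat 2 ++ (encNat 0 ++ o))), r4 := unary M,
        r5 := true :: true :: (unary x.length ++ []), r6 := unary (k + 1) } hi 4 0).mono
      (by simp [Regs.get])).congr (by simp [Regs.get, Regs.set])
  have h3 := runs_inputProg_loop { r5 := true :: true :: (unary x.length ++ []) } hi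
    (false :: (unary M ++ (false :: (encNat 2 ++ (encNat 2 ++ (encNat 0 ++ o)))))) (k + 2) 0
  have h4 : Runs inputProg (Regs.store { r0 := x, r1 := unary k } hi) (Regs.store
    { r0 := unary (k + 2) ++ false :: (unary M ++
        (false :: (encNat 2 ++ (encNat 2 ++ (encNat 0 ++ o))))), r1 := unary (k + 6),
      r5 := true :: true :: (unary x.length ++ []) } hi) _ :=
    (Runs.drainR _ hi 0 5).seq <| (Runs.pushR _ hi 5 true).seq <|
      (Runs.pushR _ hi 5 true).seq <| (Runs.pushR _ hi 1 true).seq <|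
      h1.seq <| (Runs.pushR _ hi 0 false).seq <|
      (Runs.pushR _ hi 0 false).seq <| (Runs.pushR _ hi 0 true).seq <|
      (Runs.pushR _ hi 0 true).seq <| (Runs.pushR _ hi 0 false).seq <|
      (Runs.pushR _ hi 0 true).seq <| (Runs.pushR _ hi 0 true).seq <|
      (Runs.popR _ hi 4).seq <| (Runs.pushR _ hi 0 false).seq <| h2.seq <|
      (Runs.pushR _ hi 6 true).seq <| (Runs.pushR _ hi 0 false).seq <| h3.seq <|
      (Runs.pushR _ hi 1 true).seq <| (Runs.pushR _ hi 1 true).seq <|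
      (Runs.pushR _ hi 1 true).seq (Runs.pushR _ hi 1 true)
  refine ⟨_, ?_, rfl, h4.mono ?_⟩
  · unfold formulaGame
    rw [encode_wordGame, hM, Nat.add_sub_cancel, ho]
    simp [encNat]
  · simp only [Regs.get]
    obtain ⟨A, hA⟩ : ∃ A, A = x.length + k + 1 := ⟨_, rfl⟩
    have hx : x.length + 2 ≤ 2 * A := by omega
    have hk : k + 1 ≤ A := by omega
    have hM' : M + 1 ≤ A * (2 * A) := hM ▸ Nat.mul_le_mul hk hx
    have h5 : (x.length + 2) * (7 * (k + 1) + 10) ≤ (2 * A) * (17 * A) :=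
      Nat.mul_le_mul hx (by omega)
    have h6 : (k + 1) * ((x.length + 2) * (7 * (k + 1) + 10) + 5) ≤ A * ((2 * A) * (17 * A) + 5) :=
      Nat.mul_le_mul hk (by omega)
    have h7 : A ≤ A ^ 3 := Nat.le_self_pow (by omega) A
    have h8 : A ^ 2 ≤ A ^ 3 := Nat.pow_le_pow_right (by omega) (by omega)
    rw [← hA]
    ring_nf at h6 hM' ⊢
    omega

end HDG

namespace ParamComplexity

open Machine

/-! ### The evaluator as a program -/

/-- A truth value as the content of a stack. -/
def flag : Bool → List Bool
  | false => []
  | true => [true]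

def EvalMode.code : EvalMode → List Bool
  | .header => []
  | .sign => [false]
  | .var s => [true, s]

/-- The registers holding a state of the evaluator, with a given content of the register of the
mode. -/
def EvalState.regs (σ : EvalState) (m : List Bool) (R : Regs) : Regs :=
  { R with r4 := σ.rest, r7 := σ.done, r8 := m, r10 := flag σ.second, r12 := flag σ.sat,
           r13 := flag σ.bad }

def setFlag (r : ℕ) : Prog := .seq (.pop r) (.push r true)

def advanceProg : Prog := .branch 4 (setFlag 13) (moveTop 4 7) (moveTop 4 7)

def endHeaderProg : Prog := .branch 4 .skip (setFlag 13) (setFlag 13)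

def compareProg : Prog :=
  .branch 4 (setFlag 13) (.branch 8 .skip (setFlag 12) .skip) (.branch 8 .skip .skip (setFlag 12))

def endLiteralProg : Prog :=
  .branch 10 (.push 10 true)
    (.seq (.pop 10) (.seq (.branch 12 (setFlag 13) .skip .skip) (.pop 12)))
    (.seq (.pop 10) (.seq (.branch 12 (setFlag 13) .skip .skip) (.pop 12)))

def onZeroProg : Prog :=
  .branch 8
    (.seq endHeaderProg (.seq (move 7 4) (.push 8 false)))
    (.seq (.pop 8) (.seq (.push 8 false) (.push 8 true)))
    (.seq (.pop 8) (.seq compareProg (.seq (move 7 4) (.seq endLiteralProg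
      (.seq (.pop 8) (.push 8 false))))))

def onOneProg : Prog :=
  .branch 8 advanceProg (.seq (.pop 8) (.seq (.push 8 true) (.push 8 true))) advanceProg

/-- One step of the evaluator, reading a symbol of stack `0` and moving it to stack `6`. -/
def stepProg : Prog :=
  .branch 0 .skip (.seq (moveTop 0 6) onZeroProg) (.seq (moveTop 0 6) onOneProg)

section

variable (σ : EvalState) (m : List Bool) (R : Regs) (hi : Store)

/-- Popping an empty stack has no effect, so the flag ends as a single one whatever it was before.
-/
theorem runs_setFlag (r : ℕ) (b : Bool) (h : R.get r = flag b) (hr : r < 16 := by decide) :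
    Runs (setFlag r) (R.store hi) ((R.set r (flag true)).store hi) 2 := by
  have h1 := (Runs.popR R hi r hr).seq (Runs.pushR _ hi r true hr)
  have e1 : ((R.set r (R.get r).tail).set r (true :: (R.set r (R.get r).tail).get r)).store hi =
      (R.set r (flag true)).store hi := by
    rw [← Regs.update_store _ _ hr, ← Regs.update_store _ _ hr, Function.update_idem,
      Regs.update_store _ _ hr, R.get_set hr, Function.update_self, h]
    cases b <;> rfl
  exact h1.congr e1

theorem runs_advanceProg :
    Runs advanceProg ((σ.regs m R).store hi) ((σ.advance.regs m R).store hi) 4 := by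
  obtain ⟨rest, done, mode, second, sat, bad⟩ := σ
  cases rest with
  | nil => exact (Runs.branchEmpty rfl (runs_setFlag _ hi 13 bad rfl)).mono (by omega)
  | cons b rest =>
    cases b
    · exact Runs.branchZero rfl (Runs.moveTopR _ hi 4 7 rfl)
    · exact Runs.branchOne rfl (Runs.moveTopR _ hi 4 7 rfl)

theorem runs_endHeaderProg :
    Runs endHeaderProg ((σ.regs m R).store hi) ((σ.endHeader.regs m R).store hi) 3 := by
  obtain ⟨rest, done, mode, second, sat, bad⟩ := σ
  cases rest with
  | nil => exact ((Runs.branchEmpty rfl Runs.skip).congr (by cases bad <;> rfl)).mono (by omega)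
  | cons b rest =>
    cases b
    · exact (Runs.branchZero rfl (runs_setFlag _ hi 13 bad rfl)).congr (by cases bad <;> rfl)
    · exact (Runs.branchOne rfl (runs_setFlag _ hi 13 bad rfl)).congr (by cases bad <;> rfl)

/-- The tag of the mode has been popped here, so stack `8` holds only the sign `c`. -/
theorem runs_compareProg (c : Bool) :
    Runs compareProg ((σ.regs [c] R).store hi) (((σ.compare c).regs [c] R).store hi) 4 := by
  obtain ⟨rest, done, mode, second, sat, bad⟩ := σ
  cases rest with
  | nil => exact (Runs.branchEmpty rfl (runs_setFlag _ hi 13 bad rfl)).mono (by omega)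
  | cons b rest =>
    cases b <;> cases c
    · exact (Runs.branchZero rfl (Runs.branchZero rfl (runs_setFlag _ hi 12 sat rfl))).congr
        (by cases sat <;> rfl)
    · exact ((Runs.branchZero rfl (Runs.branchOne rfl Runs.skip)).congr
        (by cases sat <;> rfl)).mono (by omega)
    · exact ((Runs.branchOne rfl (Runs.branchZero rfl Runs.skip)).congr
        (by cases sat <;> rfl)).mono (by omega)
    · exact (Runs.branchOne rfl (Runs.branchOne rfl (runs_setFlag _ hi 12 sat rfl))).congr
        (by cases sat <;> rfl)

theorem runs_endLiteralProg :
    Runs endLiteralProg ((σ.regs m R).store hi) ((σ.endLiteral.regs m R).store hi) 6 := by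
  obtain ⟨rest, done, mode, second, sat, bad⟩ := σ
  cases second with
  | false => exact (Runs.branchEmpty rfl (Runs.pushR _ hi 10 true)).mono (by omega)
  | true =>
    cases sat with
    | false =>
      exact ((Runs.branchOne rfl ((Runs.popR _ hi 10).seq ((Runs.branchEmpty rfl
        (runs_setFlag _ hi 13 bad rfl)).seq (Runs.popR _ hi 12)))).congr
        (by cases bad <;> rfl)).mono (by omega)
    | true =>
      exact ((Runs.branchOne rfl ((Runs.popR _ hi 10).seq ((Runs.branchOne rfl
        Runs.skip).seq (Runs.popR _ hi 12)))).congr (by cases bad <;> rfl)).mono (by omega)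

/-- Moving a stack reverses it, which is just what rewinding the cursor requires. -/
theorem runs_rewind :
    Runs (move 7 4) ((σ.regs m R).store hi) ((σ.rewind.regs m R).store hi)
      (4 * σ.done.length + 1) :=
  Runs.moveR _ hi 7 4

/-- Only rewinding takes more than constant time; it costs four steps per variable passed. -/
theorem runs_stepProg (b : Bool) (y u : List Bool) :
    Runs stepProg ((σ.regs σ.mode.code { R with r0 := b :: y, r6 := u }).store hi)
      (((σ.step b).regs (σ.step b).mode.code { R with r0 := y, r6 := b :: u }).store hi)
      (4 * σ.done.length + 30) := by
  have hdone : ∀ c, (σ.compare c).done = σ.done := by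
    intro c
    obtain ⟨rest, done, mode, second, sat, bad⟩ := σ
    cases rest <;> rfl
  have hmode : ∀ τ : EvalState, τ.advance.mode = τ.mode := by
    intro τ
    obtain ⟨rest, done, mode, second, sat, bad⟩ := τ
    cases rest <;> rfl
  obtain ⟨R', hR'⟩ : ∃ R' : Regs, R' = { R with r0 := y, r6 := b :: u } := ⟨_, rfl⟩
  have hmove : Runs (moveTop 0 6)
      ((σ.regs σ.mode.code { R with r0 := b :: y, r6 := u }).store hi)
      ((σ.regs σ.mode.code R').store hi) 3 := by
    rw [hR']
    exact Runs.moveTopR _ hi 0 6 rfl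
  rw [← hR']
  cases b with
  | true =>
    suffices h : Runs onOneProg ((σ.regs σ.mode.code R').store hi)
        (((σ.step true).regs (σ.step true).mode.code R').store hi) 8 from
      (Runs.branchOne rfl (hmove.seq h)).mono (by omega)
    cases hm : σ.mode with
    | header =>
      have e : σ.step true = σ.advance := by simp [EvalState.step, hm]
      rw [e, hmode, hm]
      exact (Runs.branchEmpty rfl (runs_advanceProg σ _ R' hi)).mono (by omega)
    | sign =>
      have e : σ.step true = σ.setMode (.var true) := by simp [EvalState.step, hm]
      rw [e]
      exact (Runs.branchZero rfl ((Runs.popR _ hi 8).seq ((Runs.pushR _ hi 8 true).seq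
        (Runs.pushR _ hi 8 true)))).mono (by omega)
    | var c =>
      have e : σ.step true = σ.advance := by simp [EvalState.step, hm]
      rw [e, hmode, hm]
      exact (Runs.branchOne rfl (runs_advanceProg σ _ R' hi)).mono (by omega)
  | false =>
    suffices h : Runs onZeroProg ((σ.regs σ.mode.code R').store hi)
        (((σ.step false).regs (σ.step false).mode.code R').store hi)
        (4 * σ.done.length + 20) from
      (Runs.branchZero rfl (hmove.seq h)).mono (by omega)
    cases hm : σ.mode with
    | header =>
      have e : σ.step false = σ.endHeader.rewind.setMode .sign := by simp [EvalState.step, hm]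
      rw [e]
      refine (Runs.branchEmpty rfl ((runs_endHeaderProg σ _ R' hi).seq
        ((runs_rewind _ _ R' hi).seq (Runs.pushR _ hi 8 false)))).mono ?_
      change 3 + (4 * σ.done.length + 1 + 1) + 1 ≤ _
      omega
    | sign =>
      have e : σ.step false = σ.setMode (.var false) := by simp [EvalState.step, hm]
      rw [e]
      exact (Runs.branchZero rfl ((Runs.popR _ hi 8).seq ((Runs.pushR _ hi 8 false).seq
        (Runs.pushR _ hi 8 true)))).mono (by omega)
    | var c =>
      have e : σ.step false = (σ.compare c).rewind.endLiteral.setMode .sign := by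
        simp [EvalState.step, hm]
      rw [e]
      have h1 : Runs (.pop 8) ((σ.regs (EvalMode.var c).code R').store hi)
        ((σ.regs [c] R').store hi) 1 := Runs.popR _ hi 8
      have h2 : Runs (.seq (.pop 8) (.push 8 false))
          (((σ.compare c).rewind.endLiteral.regs [c] R').store hi)
          (((σ.compare c).rewind.endLiteral.regs [false] R').store hi) 2 :=
        (Runs.popR _ hi 8).seq (Runs.pushR _ hi 8 false)
      refine (Runs.branchOne rfl (h1.seq ((runs_compareProg σ R' hi c).seq
        ((runs_rewind _ _ R' hi).seq ((runs_endLiteralProg _ _ R' hi).seq h2))))).mono ?_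
      rw [hdone]
      omega

/-- The cursor only shifts symbols between `rest` and `done`. Their total length bounds the cost of
every rewinding. -/
theorem EvalState.length_step (b : Bool) :
    (σ.step b).rest.length + (σ.step b).done.length = σ.rest.length + σ.done.length := by
  obtain ⟨rest, done, mode, second, sat, bad⟩ := σ
  cases mode <;> cases b <;> cases rest <;> cases second <;>
    simp [step, advance, rewind, compare, endLiteral, endHeader, setMode] <;> omega

theorem EvalState.length_foldl_step (y : List Bool) :
    (y.foldl step σ).rest.length + (y.foldl step σ).done.length =
      σ.rest.length + σ.done.length := by
  induction y generalizing σ with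
  | nil => rfl
  | cons b y ih => rw [List.foldl_cons, ih, length_step]

theorem runs_loop_stepProg (y u : List Bool) (W : ℕ) (hW : σ.rest.length + σ.done.length ≤ W) :
    Runs (.loop 0 stepProg) ((σ.regs σ.mode.code { R with r0 := y, r6 := u }).store hi)
      (((y.foldl EvalState.step σ).regs (y.foldl EvalState.step σ).mode.code
        { R with r0 := [], r6 := y.reverse ++ u }).store hi)
      (y.length * (4 * W + 31) + 1) := by
  induction y generalizing σ u with
  | nil => exact Runs.mono (Runs.loopNil rfl) (Nat.le_add_left _ _)
  | cons b y ih =>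
    have h := ih (σ.step b) (b :: u) (by rw [σ.length_step]; exact hW)
    refine ((Runs.loopCons rfl (runs_stepProg σ R hi b y u) h).mono ?_).congr ?_
    · rw [List.length_cons, Nat.add_mul y.length 1]
      omega
    · simp

end

end ParamComplexity

namespace HDG

open Machine ParamComplexity

/-! ### Reading a coalition -/

/-- Read a block of the characteristic vector on stack `2`; the length of the block is the height of
stack `0`. -/
def readBlockProg : Prog :=
  .seq (.loop 0 (.seq (moveTop 0 6)
    (.seq (.branch 2 .skip .skip (.seq (.push 4 false) (.push 9 true))) (.pop 2)))) (move 6 0)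

/-- Stack `0` serves only as a counter for the block length. Each member found adds a zero to the
word on stack `4` and a one to the count on stack `9`. -/
theorem runs_readBlockProg_loop (R : Regs) (hi : Store) (y bs q w u : List Bool) (o : ℕ)
    (h : y.length = bs.length) :
    Runs (.loop 0 (.seq (moveTop 0 6)
        (.seq (.branch 2 .skip .skip (.seq (.push 4 false) (.push 9 true))) (.pop 2))))
      (Regs.store { R with r0 := y, r2 := bs ++ q, r4 := w, r6 := u, r9 := unary o } hi)
      (Regs.store { R with
        r0 := [], r2 := q, r4 := List.replicate (bs.count true) false ++ w, r6 := y.reverse ++ u,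
        r9 := unary (bs.count true + o) } hi) (y.length * 8 + 1) := by
  induction y generalizing bs w u o with
  | nil =>
    obtain rfl : bs = [] := List.eq_nil_of_length_eq_zero h.symm
    refine Runs.congr (Runs.mono (Runs.loopNil rfl) (Nat.le_add_left _ _)) ?_
    rw [List.count_nil, Nat.zero_add]
    rfl
  | cons c y ih =>
    cases bs with
    | nil => simp at h
    | cons b bs =>
      have hl : y.length = bs.length := by simpa using h
      cases b with
      | false =>
        refine ((Runs.loopCons rfl ((Runs.moveTopR _ hi 0 6 rfl).seq ((Runs.branchZero rfl
          Runs.skip).seq (Runs.popR _ hi 2))) (ih bs w (c :: u) o hl)).mono ?_).congr ?_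
        · simp only [List.length_cons]
          omega
        · simp
      | true =>
        refine ((Runs.loopCons rfl ((Runs.moveTopR _ hi 0 6 rfl).seq ((Runs.branchOne rfl
          ((Runs.pushR _ hi 4 false).seq (Runs.pushR _ hi 9 true))).seq (Runs.popR _ hi 2)))
          (ih bs (false :: w) (c :: u) (o + 1) hl)).mono ?_).congr ?_
        · simp only [List.length_cons]
          omega
        · have e : List.replicate (bs.count true) false ++ false :: w =
              List.replicate (bs.count true + 1) false ++ w := by
            rw [List.replicate_succ', List.append_assoc]
            rfl
          rw [List.count_cons_self, e, add_right_comm _ 1 o, add_assoc _ o 1]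
          simp

theorem runs_readBlockProg (R : Regs) (hi : Store) (y bs q w : List Bool) (o : ℕ)
    (h : y.length = bs.length) :
    Runs readBlockProg
      (Regs.store { R with r0 := y, r2 := bs ++ q, r4 := w, r6 := [], r9 := unary o } hi)
      (Regs.store { R with
        r0 := y, r2 := q, r4 := List.replicate (bs.count true) false ++ w, r6 := [],
        r9 := unary (bs.count true + o) } hi) (y.length * 12 + 2) := by
  refine (((runs_readBlockProg_loop R hi y bs q w [] o h).seq
    (Runs.moveR _ hi 6 0)).mono ?_).congr ?_
  · simp [Regs.get]
    omega
  · simp [Regs.get, Regs.set]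

/-- Read all blocks; their number is on stack `1`, and is moved to stack `5`. -/
def readBlocksProg : Prog :=
  .loop 1 (.seq readBlockProg (.seq (.push 4 true) (.seq (.pop 1) (.push 5 true))))

theorem runs_readBlocksProg (R : Regs) (hi : Store) (y : List Bool) (Bs : List (List Bool))
    (q w : List Bool) (e o : ℕ) (h : ∀ bs ∈ Bs, y.length = bs.length) :
    Runs readBlocksProg
      (Regs.store { R with
        r0 := y, r1 := unary Bs.length, r2 := Bs.flatten ++ q, r4 := w, r5 := unary e, r6 := [],
        r9 := unary o } hi)
      (Regs.store { R with
        r0 := y, r1 := [], r2 := q, r4 := (Bs.map (List.count true)).foldl addBlock w,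
        r5 := unary (Bs.length + e), r6 := [],
        r9 := unary ((Bs.map (List.count true)).sum + o) } hi)
      (Bs.length * (y.length * 12 + 6) + 1) := by
  induction Bs generalizing w e o with
  | nil =>
    refine Runs.congr (Runs.mono (Runs.loopNil rfl) (Nat.le_add_left _ _)) ?_
    simp
    rfl
  | cons bs Bs ih =>
    have h1 := runs_readBlockProg
      { R with r1 := unary (Bs.length + 1), r5 := unary e } hi y bs (Bs.flatten ++ q) w o
      (h bs List.mem_cons_self)
    have h2 := ih (addBlock w (bs.count true)) (e + 1) (bs.count true + o)
      (fun b hb => h b (List.mem_cons_of_mem _ hb))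
    rw [List.flatten_cons, List.append_assoc]
    refine ((Runs.loopCons rfl (h1.seq ((Runs.pushR _ hi 4 true).seq ((Runs.popR _ hi 1).seq
      (Runs.pushR _ hi 5 true)))) h2).mono ?_).congr ?_
    · rw [List.length_cons, Nat.add_mul _ 1]
      omega
    · rw [List.length_cons, add_right_comm _ 1 e, add_assoc _ e 1, List.map_cons, List.foldl_cons,
        List.sum_cons, add_comm (bs.count true) (List.sum _), add_assoc]

end HDG

namespace HDG

open Machine ParamComplexity

/-! ### The preference oracle -/

/-- Prepare the evaluator for the word on stack `4`. -/
def initProg : Prog :=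
  .seq (.pop 4) (.seq (.branch 4 (setFlag 13) .skip (setFlag 13)) (.pop 4))

theorem runs_initProg (R : Regs) (hi : Store) (w : List Bool) :
    Runs initProg
      (Regs.store { R with r4 := w, r7 := [], r8 := [], r10 := [], r12 := [], r13 := [] } hi)
      (((EvalState.init w).regs (EvalState.init w).mode.code R).store hi) 5 := by
  cases w with
  | nil =>
    exact ((Runs.popR _ hi 4).seq ((Runs.branchEmpty rfl (runs_setFlag _ hi 13 false rfl)).seq
      (Runs.popR _ hi 4))).mono (by omega)
  | cons a w =>
    cases w with
    | nil =>
      exact ((Runs.popR _ hi 4).seq ((Runs.branchEmpty rfl (runs_setFlag _ hi 13 false rfl)).seq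
        (Runs.popR _ hi 4))).mono (by omega)
    | cons b w =>
      cases b with
      | false =>
        exact ((Runs.popR _ hi 4).seq ((Runs.branchZero rfl Runs.skip).seq
          (Runs.popR _ hi 4))).mono (by omega)
      | true =>
        exact ((Runs.popR _ hi 4).seq ((Runs.branchOne rfl (runs_setFlag _ hi 13 false rfl)).seq
          (Runs.popR _ hi 4))).mono (by omega)

def acceptProg : Prog :=
  .branch 13 (.branch 8 .skip (.branch 10 (.seq (.push 14 true) (.push 14 true)) .skip .skip) .skip)
    .skip .skip

open Classical in
-- Among the codes of the modes, only that of `sign` has a zero on top, so three tests decide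
-- acceptance.
theorem runs_acceptProg (σ : EvalState) (R : Regs) (hi : Store) :
    Runs acceptProg ((σ.regs σ.mode.code { R with r14 := [] }).store hi)
      ((σ.regs σ.mode.code { R with r14 := unary (if σ.accepting then 2 else 0) }).store hi) 5 := by
  obtain ⟨rest, done, mode, second, sat, bad⟩ := σ
  cases bad with
  | true =>
    rw [if_neg (by simp [EvalState.accepting])]
    exact (Runs.branchOne rfl Runs.skip).mono (by omega)
  | false =>
    cases mode with
    | header =>
      rw [if_neg (by simp [EvalState.accepting])]
      exact (Runs.branchEmpty rfl (Runs.branchEmpty rfl Runs.skip)).mono (by omega)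
    | var c =>
      rw [if_neg (by simp [EvalState.accepting])]
      exact (Runs.branchEmpty rfl (Runs.branchOne rfl Runs.skip)).mono (by omega)
    | sign =>
      cases second with
      | true =>
        rw [if_neg (by simp [EvalState.accepting])]
        exact (Runs.branchEmpty rfl (Runs.branchZero rfl (Runs.branchOne rfl Runs.skip))).mono
          (by omega)
      | false =>
        rw [if_pos (by simp [EvalState.accepting])]
        exact (Runs.branchEmpty rfl (Runs.branchZero rfl (Runs.branchEmpty rfl
          ((Runs.pushR _ hi 14 true).seq (Runs.pushR _ hi 14 true))))).mono (by omega)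

/-- Compute the utility of the coalition that has been read, on stack `14`. -/
def resultProg : Prog :=
  .branch 3 .skip .skip (.branch 9 (.push 14 true) acceptProg acceptProg)

open Classical in
/-- The utility of a coalition with `t` members besides the agent `0`, whose membership is `b`. -/
noncomputable def resultValue (σ : EvalState) (b : Bool) (t : ℕ) : ℕ :=
  if b = true then if t = 0 then 1 else if σ.accepting then 2 else 0 else 0

theorem runs_resultProg (σ : EvalState) (b : Bool) (t : ℕ) (R : Regs) (hi : Store) :
    Runs resultProg
      ((σ.regs σ.mode.code { R with r3 := flag b, r9 := unary t, r14 := [] }).store hi)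
      ((σ.regs σ.mode.code
        { R with r3 := flag b, r9 := unary t, r14 := unary (resultValue σ b t) }).store hi) 7 := by
  cases b with
  | false => exact Runs.mono (T := 2) (Runs.branchEmpty rfl Runs.skip) (by omega)
  | true =>
    cases t with
    | zero =>
      exact Runs.mono (T := 3)
        (Runs.branchOne rfl (Runs.branchEmpty rfl (Runs.pushR _ hi 14 true))) (by omega)
    | succ t =>
      exact Runs.branchOne rfl (Runs.branchOne rfl (runs_acceptProg σ
        { R with r3 := flag true, r9 := unary (t + 1) } hi))

def cleanProg : Prog :=
  .seq (clear 3) <| .seq (clear 4) <| .seq (clear 7) <| .seq (clear 8) <| .seq (clear 9) <|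
    .seq (clear 10) <| .seq (clear 12) (clear 13)

theorem runs_cleanProg (R : Regs) (hi : Store) :
    Runs cleanProg (R.store hi)
      (Regs.store { R with r3 := [], r4 := [], r7 := [], r8 := [], r9 := [], r10 := [], r12 := [],
                           r13 := [] } hi)
      (2 * (R.r3.length + R.r4.length + R.r7.length + R.r8.length + R.r9.length + R.r10.length +
        R.r12.length + R.r13.length) + 8) := by
  obtain ⟨a0, a1, a2, a3, a4, a5, a6, a7, a8, a9, a10, a11, a12, a13, a14, a15⟩ := R
  refine Runs.mono ((Runs.clearR _ hi 3).seq <| (Runs.clearR _ hi 4).seq <|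
    (Runs.clearR _ hi 7).seq <| (Runs.clearR _ hi 8).seq <| (Runs.clearR _ hi 9).seq <|
    (Runs.clearR _ hi 10).seq <| (Runs.clearR _ hi 12).seq (Runs.clearR _ hi 13)) ?_
  simp only [Regs.get, Regs.set]
  omega

/-- Read a coalition from stack `2`, and push its utility for the agent `0` on stack `14`. -/
def utilityProg : Prog :=
  .seq (.branch 2 .skip .skip (.push 3 true)) <| .seq (.pop 2) <|
  .seq (.push 0 true) <| .seq (.push 0 true) <| .seq (.push 1 true) <|
  .seq readBlocksProg <| .seq (.pop 0) <| .seq (.pop 0) <|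
  .seq (drain 5 1) <| .seq (.pop 1) <| .seq initProg <| .seq (.loop 0 stepProg) <|
  .seq (move 6 0) <| .seq resultProg cleanProg

theorem length_flag_le (b : Bool) : (flag b).length ≤ 1 := by
  cases b <;> simp [flag]

-- Two symbols pushed on `x` for a while turn its height into the block length `|x| + 2`. The time
-- is cubic: the word of the coalition has quadratic length, and each symbol of `x` may cause it to
-- be rewound.
set_option maxHeartbeats 2000000 in
theorem runs_utilityProg (x : List Bool) (b : Bool) (Bs : List (List Bool)) (q v : List Bool)
    (k : ℕ) (hk : Bs.length = k + 1) (hBs : ∀ bs ∈ Bs, bs.length = x.length + 2) (hi : Store) :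
    Runs utilityProg
      (Regs.store { r0 := x, r1 := unary k, r2 := b :: (Bs.flatten ++ q), r15 := v } hi)
      (Regs.store
        { r0 := x, r1 := unary k, r2 := q, r14 := unary (resultValue (x.foldl EvalState.step
          (EvalState.init (blockWord (Bs.map (List.count true))))) b
          (Bs.map (List.count true)).sum), r15 := v } hi)
      (200 * (x.length + k + 2) ^ 3) := by
  obtain ⟨ms, hms⟩ : ∃ ms, ms = Bs.map (List.count true) := ⟨_, rfl⟩
  obtain ⟨w, hw⟩ : ∃ w, w = blockWord ms := ⟨_, rfl⟩
  have h1 : Runs (.branch 2 .skip .skip (.push 3 true))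
      (Regs.store { r0 := x, r1 := unary k, r2 := b :: (Bs.flatten ++ q), r15 := v } hi)
      (Regs.store
        { r0 := x, r1 := unary k, r2 := b :: (Bs.flatten ++ q), r3 := flag b, r15 := v } hi) 2 := by
    cases b
    · exact Runs.branchZero rfl Runs.skip
    · exact Runs.branchOne rfl (Runs.pushR _ hi 3 true)
  have h2 := runs_readBlocksProg { r3 := flag b, r15 := v } hi (true :: true :: x) Bs q [] 0 0
    (fun bs hbs => by rw [hBs bs hbs]; rfl)
  rw [hk, ← hms, show ms.foldl addBlock [] = w from hw.symm] at h2
  have h3 : Runs (drain 5 1)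
      (Regs.store
        { r0 := x, r2 := q, r3 := flag b, r4 := w, r5 := unary (k + 1 + 0),
          r9 := unary (ms.sum + 0), r15 := v } hi)
      (Regs.store
        { r0 := x, r1 := unary (k + 1), r2 := q, r3 := flag b, r4 := w,
          r9 := unary ms.sum, r15 := v } hi) (3 * (k + 1) + 1) := by
    refine ((Runs.drainR _ hi 5 1).mono ?_).congr ?_ <;> simp [Regs.get, Regs.set]
  have h4 := runs_initProg
    { r0 := x, r1 := unary k, r2 := q, r3 := flag b, r9 := unary ms.sum, r15 := v } hi w
  obtain ⟨σ, hσ⟩ : ∃ σ, σ = x.foldl EvalState.step (EvalState.init w) := ⟨_, rfl⟩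
  have hlen : (EvalState.init w).rest.length + (EvalState.init w).done.length ≤ w.length := by
    simp [EvalState.init]
    omega
  have h5 := runs_loop_stepProg (EvalState.init w)
    { r1 := unary k, r2 := q, r3 := flag b, r9 := unary ms.sum, r15 := v } hi x [] w.length hlen
  rw [← hσ] at h5
  have h6 : Runs (move 6 0)
      ((σ.regs σ.mode.code
        { r1 := unary k, r2 := q, r3 := flag b, r6 := x.reverse ++ [], r9 := unary ms.sum,
          r15 := v }).store hi)
      ((σ.regs σ.mode.code
        { r0 := x, r1 := unary k, r2 := q, r3 := flag b, r9 := unary ms.sum,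
          r15 := v }).store hi) (4 * x.length + 1) := by
    refine ((Runs.moveR _ hi 6 0).mono ?_).congr ?_ <;>
      simp [Regs.get, Regs.set, EvalState.regs]
  have h7 := runs_resultProg σ b ms.sum
    { r0 := x, r1 := unary k, r2 := q, r15 := v } hi
  have h8 := runs_cleanProg (σ.regs σ.mode.code
    { r0 := x, r1 := unary k, r2 := q, r3 := flag b, r9 := unary ms.sum,
      r14 := unary (resultValue σ b ms.sum), r15 := v }) hi
  rw [← hms, ← hw, ← hσ]
  have p1 : Runs (.pop 2)
      (Regs.store
        { r0 := x, r1 := unary k, r2 := b :: (Bs.flatten ++ q), r3 := flag b, r15 := v } hi)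
      (Regs.store
        { r0 := x, r1 := unary k, r2 := Bs.flatten ++ q, r3 := flag b, r15 := v } hi) 1 :=
    Runs.popR _ hi 2
  have p2 : Runs (.pop 0)
      (Regs.store
        { r0 := true :: true :: x, r2 := q, r3 := flag b, r4 := w, r5 := unary (k + 1 + 0),
          r9 := unary (ms.sum + 0), r15 := v } hi)
      (Regs.store
        { r0 := true :: x, r2 := q, r3 := flag b, r4 := w, r5 := unary (k + 1 + 0),
          r9 := unary (ms.sum + 0), r15 := v } hi) 1 := Runs.popR _ hi 0
  have p3 : Runs (.pop 0)
      (Regs.store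
        { r0 := true :: x, r2 := q, r3 := flag b, r4 := w, r5 := unary (k + 1 + 0),
          r9 := unary (ms.sum + 0), r15 := v } hi)
      (Regs.store
        { r0 := x, r2 := q, r3 := flag b, r4 := w, r5 := unary (k + 1 + 0),
          r9 := unary (ms.sum + 0), r15 := v } hi) 1 := Runs.popR _ hi 0
  have p4 : Runs (.pop 1)
      (Regs.store
        { r0 := x, r1 := unary (k + 1), r2 := q, r3 := flag b, r4 := w,
          r9 := unary ms.sum, r15 := v } hi)
      (Regs.store
        { r0 := x, r1 := unary k, r2 := q, r3 := flag b, r4 := w,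
          r9 := unary ms.sum, r15 := v } hi) 1 := Runs.popR _ hi 1
  refine Runs.mono (h1.seq <| p1.seq <| (Runs.pushR _ hi 0 true).seq <|
    (Runs.pushR _ hi 0 true).seq <| (Runs.pushR _ hi 1 true).seq <| h2.seq <|
    p2.seq <| p3.seq <| h3.seq <| p4.seq <|
    h4.seq <| h5.seq <| h6.seq <| h7.seq h8) ?_
  have hsum : ms.sum ≤ (k + 1) * (x.length + 2) := by
    rw [← smul_eq_mul, ← hk, ← List.length_map (f := List.count true), ← hms]
    refine List.sum_le_card_nsmul ms _ fun m hm => ?_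
    rw [hms] at hm
    obtain ⟨bs, hbs, rfl⟩ := List.mem_map.mp hm
    exact List.count_le_length.trans (hBs bs hbs).le
  have hwl : w.length = k + 1 + ms.sum := by
    rw [hw, length_blockWord, hms, List.length_map, hk]
  have hσl := EvalState.length_foldl_step (EvalState.init w) x
  rw [← hσ] at hσl
  have hcode : σ.mode.code.length ≤ 2 := by
    cases σ.mode <;> simp [EvalMode.code]
  have f1 := length_flag_le b
  have f2 := length_flag_le σ.second
  have f3 := length_flag_le σ.sat
  have f4 := length_flag_le σ.bad
  simp only [EvalState.regs, length_unary, List.length_cons]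
  obtain ⟨A, hA⟩ : ∃ A, A = x.length + k + 2 := ⟨_, rfl⟩
  have hW : w.length ≤ A + A * A := by
    have : (k + 1) * (x.length + 2) ≤ A * A := Nat.mul_le_mul (by omega) (by omega)
    omega
  have hsum' : ms.sum ≤ A * A := hsum.trans (Nat.mul_le_mul (by omega) (by omega))
  have t1 : (k + 1) * ((x.length + 1 + 1) * 12 + 6) ≤ A * (18 * A) :=
    Nat.mul_le_mul (by omega) (by omega)
  have t2 : x.length * (4 * w.length + 31) ≤ A * (4 * (A + A * A) + 31) :=
    Nat.mul_le_mul (by omega) (by omega)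
  have t3 : A ≤ A ^ 3 := Nat.le_self_pow (by omega) A
  have t4 : A ^ 2 ≤ A ^ 3 := Nat.pow_le_pow_right (by omega) (by omega)
  have e1 : A * (4 * (A + A * A) + 31) = 4 * A ^ 2 + 4 * A ^ 3 + 31 * A := by ring
  have e2 : A * (18 * A) = 18 * A ^ 2 := by ring
  have e3 : A * A = A ^ 2 := by ring
  rw [← hA]
  rw [e1] at t2
  rw [e2] at t1
  rw [e3] at hW hsum'
  omega

/-- The program counts the members other than agent `0`; when agent `0` belongs to `X`, it is alone
exactly if this count is zero. -/
theorem resultValue_eq_utility (x : List Bool) {k : ℕ}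
    (X : Finset (Fin (agentCount (x.length + 2) k))) :
    resultValue (x.foldl EvalState.step (EvalState.init (blockWord
      ((List.ofFn (blockBits X)).map (List.count true))))) (decide (0 ∈ X))
      ((List.ofFn (blockBits X)).map (List.count true)).sum = utility (Accepts x) X := by
  have e : (List.ofFn (blockBits X)).map (List.count true) = blockCounts X := by
    rw [List.map_ofFn]
    rfl
  rw [e]
  unfold resultValue utility
  by_cases h0 : 0 ∈ X
  · have hcard : X.card = 1 ↔ (blockCounts X).sum = 0 := by
      rw [List.sum_eq_zero_iff]
      constructor
      · intro h m hm
        obtain ⟨c, rfl⟩ := List.mem_ofFn.mp hm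
        rw [List.count_eq_zero]
        intro hmem
        obtain ⟨j, hj⟩ := List.mem_ofFn.mp hmem
        obtain ⟨i, rfl⟩ := Finset.card_eq_one.mp h
        rw [decide_eq_true_eq, Finset.mem_singleton] at hj
        rw [Finset.mem_singleton] at h0
        exact agentAt_ne_zero c j (hj.trans h0.symm)
      · intro h
        rw [Finset.card_eq_one]
        refine ⟨0, Finset.eq_singleton_iff_unique_mem.mpr ⟨h0, fun i hi => ?_⟩⟩
        by_contra hne
        obtain ⟨c, j, rfl⟩ := exists_agentAt hne
        have := h _ (List.mem_ofFn.mpr ⟨c, rfl⟩)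
        rw [List.count_eq_zero] at this
        exact this (List.mem_ofFn.mpr ⟨j, decide_eq_true hi⟩)
    simp only [h0, decide_true, if_true, hcard]
    rfl
  · simp [h0]

/-- Remove the height of stack `14` from stack `15`; stack `13` receives the excess. -/
def subtractProg : Prog :=
  .loop 14 (.seq (.pop 14) (.seq (.branch 15 (.push 13 true) .skip .skip) (.pop 15)))

theorem runs_subtractProg (R : Regs) (hi : Store) (a b e : ℕ) :
    Runs subtractProg (Regs.store { R with r13 := unary e, r14 := unary a, r15 := unary b } hi)
      (Regs.store { R with r13 := unary (a - b + e), r14 := [], r15 := unary (b - a) } hi)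
      (a * 5 + 1) := by
  induction a generalizing b e with
  | zero =>
    refine Runs.congr (Runs.mono (Runs.loopNil rfl) (Nat.le_add_left _ _)) ?_
    rw [Nat.zero_sub, Nat.zero_add]
    rfl
  | succ a ih =>
    cases b with
    | zero =>
      have h : Runs (.seq (.pop 14) (.seq (.branch 15 (.push 13 true) .skip .skip) (.pop 15)))
          (Regs.store { R with r13 := unary e, r14 := unary (a + 1), r15 := unary 0 } hi)
          (Regs.store { R with r13 := unary (e + 1), r14 := unary a, r15 := unary 0 } hi) 4 :=
        (Runs.popR _ hi 14).seq ((Runs.branchEmpty rfl (Runs.pushR _ hi 13 true)).seq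
          (Runs.popR _ hi 15))
      refine Runs.congr (Runs.mono (Runs.loopCons rfl h (ih 0 (e + 1))) (by omega)) ?_
      rw [show a - 0 + (e + 1) = a + 1 - 0 + e by omega, Nat.zero_sub, Nat.zero_sub]
    | succ b =>
      have h : Runs (.seq (.pop 14) (.seq (.branch 15 (.push 13 true) .skip .skip) (.pop 15)))
          (Regs.store { R with r13 := unary e, r14 := unary (a + 1), r15 := unary (b + 1) } hi)
          (Regs.store { R with r13 := unary e, r14 := unary a, r15 := unary b } hi) 4 :=
        (Runs.popR _ hi 14).seq ((Runs.branchOne rfl Runs.skip).seq (Runs.popR _ hi 15))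
      refine Runs.congr (Runs.mono (Runs.loopCons rfl h (ih b e)) (by omega)) ?_
      rw [Nat.add_sub_add_right, Nat.add_sub_add_right]

/-- From `x`, `k` and a query to the preference oracle of the game of `(x, k)`, compute the
answer. -/
def oracleProg : Prog :=
  .branch 2 .skip
    (.seq (.pop 2) <| .seq utilityProg <| .seq (drain 14 15) <| .seq utilityProg <|
      .seq subtractProg <| .seq (clear 0) (.branch 13 (.push 0 true) (.push 0 false) (.push 0 false)))
    (.seq (clear 0) (.push 0 true))

theorem runs_oracleProg (x : List Bool) (k : ℕ) (q : (formulaGame x k).Query) (hi : Store) :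
    ∃ (R : Regs) (b : Bool), R.r0 = [b] ∧
      (b = true ↔ (formulaGame x k).WeakPref q.agent q.left q.right) ∧
      Runs oracleProg
        (Regs.store { r0 := x, r1 := unary k, r2 := (formulaGame x k).encodeQuery q } hi)
        (R.store hi) (500 * (x.length + k + 2) ^ 3) := by
  obtain ⟨X, Y, i, hq, hans⟩ :=
    encodeQuery_wordGame (N := x.length + 2) (k := k) (Nat.succ_pos _) (Accepts x) q
  have hq' : (formulaGame x k).encodeQuery q = _ := hq
  have hans' : (formulaGame x k).WeakPref q.agent q.left q.right ↔ _ := hans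
  rw [hq', hans']
  have hA : x.length + k + 2 ≤ (x.length + k + 2) ^ 3 := Nat.le_self_pow (by omega) _
  by_cases hi0 : i = 0
  · subst hi0
    simp only [true_imp_iff]
    have hlen : ∀ X : Finset (Fin (agentCount (x.length + 2) k)),
        ∀ bs ∈ List.ofFn (blockBits X), bs.length = x.length + 2 := by
      intro X bs hbs
      obtain ⟨c, rfl⟩ := List.mem_ofFn.mp hbs
      exact length_blockBits X c
    have h1 := runs_utilityProg x (decide (0 ∈ X)) (List.ofFn (blockBits X))
      (decide (0 ∈ Y) :: ((List.ofFn (blockBits Y)).flatten ++ [])) [] k (by simp) (hlen X) hi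
    have h2 := runs_utilityProg x (decide (0 ∈ Y)) (List.ofFn (blockBits Y)) []
      (unary (utility (Accepts x) X)) k (by simp) (hlen Y) hi
    rw [resultValue_eq_utility] at h1 h2
    have hXu := utility_le (Accepts x) X
    have hYu := utility_le (Accepts x) Y
    obtain ⟨a, ha⟩ : ∃ a, a = utility (Accepts x) X := ⟨_, rfl⟩
    obtain ⟨b, hb⟩ : ∃ b, b = utility (Accepts x) Y := ⟨_, rfl⟩
    rw [← ha] at h1 h2 hXu ⊢
    rw [← hb] at h2 hYu ⊢
    have h3 : Runs (drain 14 15)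
        (Regs.store
          { r0 := x, r1 := unary k,
            r2 := decide (0 ∈ Y) :: ((List.ofFn (blockBits Y)).flatten ++ []), r14 := unary a } hi)
        (Regs.store
          { r0 := x, r1 := unary k,
            r2 := decide (0 ∈ Y) :: ((List.ofFn (blockBits Y)).flatten ++ []), r15 := unary a } hi) (3 * a + 1) := by
      refine ((Runs.drainR _ hi 14 15).mono ?_).congr ?_ <;> simp [Regs.get, Regs.set]
    -- Stack `13` receives the truncated difference `b - a`, which is empty exactly when `b ≤ a`.
    have h4 := runs_subtractProg { r0 := x, r1 := unary k } hi b a 0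
    have h5 : Runs (.branch 13 (.push 0 true) (.push 0 false) (.push 0 false))
        (Regs.store { r1 := unary k, r13 := unary (b - a + 0), r15 := unary (a - b) } hi)
        (Regs.store
          { r0 := [decide (b ≤ a)], r1 := unary k, r13 := unary (b - a + 0),
            r15 := unary (a - b) } hi) 2 := by
      by_cases hle : b ≤ a
      · rw [Nat.sub_eq_zero_of_le hle, decide_eq_true hle]
        exact Runs.branchEmpty rfl (Runs.pushR _ hi 0 true)
      · obtain ⟨c, hc⟩ : ∃ c, b - a + 0 = c + 1 := ⟨b - a - 1, by omega⟩
        rw [hc, decide_eq_false hle]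
        exact Runs.branchOne rfl (Runs.pushR _ hi 0 false)
    have e : encNat ((0 : Fin (agentCount (x.length + 2) k)) : ℕ) ++
        decide (0 ∈ X) :: (List.ofFn (blockBits X)).flatten ++
        decide (0 ∈ Y) :: (List.ofFn (blockBits Y)).flatten =
        false :: decide (0 ∈ X) :: ((List.ofFn (blockBits X)).flatten ++
          decide (0 ∈ Y) :: ((List.ofFn (blockBits Y)).flatten ++ [])) := by
      simp [encNat, unary]
    rw [e]
    refine ⟨_, decide (b ≤ a), ?_, decide_eq_true_iff, Runs.mono (Runs.branchZero rfl
      ((Runs.popR _ hi 2).seq <| h1.seq <| h3.seq <| h2.seq <| h4.seq <|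
        (Runs.clearR _ hi 0).seq h5)) ?_⟩
    · rfl
    · simp only [Regs.get]
      omega
  -- The unary code of any other agent starts with a one; such an agent is indifferent and the
  -- answer is yes.
  · obtain ⟨m, hm⟩ : ∃ m, (i : ℕ) = m + 1 :=
      Nat.exists_eq_succ_of_ne_zero fun h => hi0 (Fin.ext h)
    rw [hm]
    refine ⟨_, true, ?_, by simp [hi0], Runs.mono (Runs.branchOne rfl
      ((Runs.clearR _ hi 0).seq (Runs.pushR _ hi 0 true))) ?_⟩
    · rfl
    · simp only [Regs.get]
      omega

end HDG

namespace HDG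

open Machine ParamComplexity

/-! ### Composition with a given reduction -/

/-- Run `p` on the words of the stacks `0` and `1`, and then `main` on the results and on the word
of stack `2`. -/
def afterProg (p main : Prog) : Prog :=
  .seq (move 2 3) <| .seq (move 0 2) <| .seq (move 2 16) <| .seq (drain 1 17) <|
  .seq (p.shift 16) <| .seq (move 16 2) <| .seq (move 2 0) <| .seq (drain 17 1) <|
  .seq (move 3 2) main

theorem initStore_eq (x y z : List Bool) :
    initStore x y z = Regs.store { r0 := x, r1 := y, r2 := z } (fun _ => []) := by
  funext i
  by_cases hi : i < 16
  · interval_cases i <;> rfl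
  · obtain ⟨j, rfl⟩ : ∃ j, i = j + 16 := ⟨i - 16, by omega⟩
    exact (join_add 16 _ (fun _ => []) j).symm

/-- The stacks from `16` on form the empty memory in which `p` starts. Each word is moved twice, so
its order is restored. Whatever `p` leaves behind, apart from its two results, remains in `hi`. -/
theorem runs_afterProg {p : Prog} {x y q : List Bool} {k k' : ℕ} {s : Store} {t : ℕ}
    (h : Exec p (initStore x (unary k) []) s t) (hy : s 0 = y) (hk : s 1 = unary k') :
    ∃ hi : Store, ∀ (main : Prog) (s' : Store) (T : ℕ),
      Runs main (Regs.store { r0 := y, r1 := unary k', r2 := q } hi) s' T →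
      Runs (afterProg p main) (initStore x (unary k) q) s'
        (T + t + (8 * (x.length + y.length + q.length) + 3 * (k + k') + 8)) := by
  have move_up : ∀ (w : List Bool) (R : Regs) (hi : Store),
      Runs (move 2 16) (Regs.store { R with r2 := w } hi)
        (Regs.store { R with r2 := [] } (Function.update hi 0 (w.reverse ++ hi 0)))
        (4 * w.length + 1) := by
    intro w R hi
    have h1 := runs_move (a := 2) (b := 16) (by decide) (Regs.store { R with r2 := w } hi)
    exact h1.congr ((congrArg (fun u : Store => Function.update u 2 [])
      (update_join_add 16 _ hi 0 _)).trans (Regs.update_store _ _ (by decide) _))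
  have drain_up : ∀ (m : ℕ) (R : Regs) (hi : Store), hi 1 = [] →
      Runs (drain 1 17) (Regs.store { R with r1 := unary m } hi)
        (Regs.store { R with r1 := [] } (Function.update hi 1 (unary m))) (3 * m + 1) := by
    intro m R hi h0
    have h1 := runs_drain (a := 1) (b := 17) (by decide) (Regs.store { R with r1 := unary m } hi)
    have e1 : Regs.store { R with r1 := unary m } hi 1 = unary m := rfl
    have e2 : Regs.store { R with r1 := unary m } hi 17 = hi 1 := rfl
    rw [e1, e2, h0, List.append_nil, length_unary] at h1
    exact h1.congr ((congrArg (fun u : Store => Function.update u 1 [])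
      (update_join_add 16 _ hi 1 _)).trans (Regs.update_store _ _ (by decide) _))
  have move_down : ∀ (R : Regs) (hi : Store),
      Runs (move 16 2) (Regs.store { R with r2 := [] } hi)
        (Regs.store { R with r2 := (hi 0).reverse } (Function.update hi 0 []))
        (4 * (hi 0).length + 1) := by
    intro R hi
    have h1 := runs_move (a := 16) (b := 2) (by decide) (Regs.store { R with r2 := [] } hi)
    have e1 : Regs.store { R with r2 := [] } hi 16 = hi 0 := rfl
    have e2 : Regs.store { R with r2 := [] } hi 2 = [] := rfl
    rw [e1, e2, List.append_nil] at h1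
    exact h1.congr ((congrArg (fun u : Store => Function.update u 16 [])
      (Regs.update_store _ _ (by decide) _)).trans (update_join_add 16 _ hi 0 _))
  have drain_down : ∀ (m : ℕ) (R : Regs) (hi : Store), hi 1 = unary m →
      Runs (drain 17 1) (Regs.store { R with r1 := [] } hi)
        (Regs.store { R with r1 := unary m } (Function.update hi 1 [])) (3 * m + 1) := by
    intro m R hi h0
    have h1 := runs_drain (a := 17) (b := 1) (by decide) (Regs.store { R with r1 := [] } hi)
    have e1 : Regs.store { R with r1 := [] } hi 17 = hi 1 := rfl
    have e2 : Regs.store { R with r1 := [] } hi 1 = [] := rfl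
    rw [e1, e2, h0, List.append_nil, length_unary] at h1
    exact h1.congr ((congrArg (fun u : Store => Function.update u 17 [])
      (Regs.update_store _ _ (by decide) _)).trans (update_join_add 16 _ hi 1 _))
  refine ⟨Function.update (Function.update s 0 []) 1 [], fun main s' T hmain => ?_⟩
  rw [initStore_eq]
  have a1 : Runs (move 2 3) (Regs.store { r0 := x, r1 := unary k, r2 := q } fun _ => [])
      (Regs.store { r0 := x, r1 := unary k, r3 := q.reverse } fun _ => []) (4 * q.length + 1) :=
    (Runs.moveR _ _ 2 3).congr (by simp [Regs.get, Regs.set])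
  have a2 : Runs (move 0 2) (Regs.store { r0 := x, r1 := unary k, r3 := q.reverse } fun _ => [])
      (Regs.store { r1 := unary k, r2 := x.reverse, r3 := q.reverse } fun _ => [])
      (4 * x.length + 1) :=
    (Runs.moveR _ _ 0 2).congr (by simp [Regs.get, Regs.set])
  have a3 := move_up x.reverse { r1 := unary k, r3 := q.reverse } (fun _ => [])
  rw [List.reverse_reverse, List.append_nil, List.length_reverse] at a3
  have a4 := drain_up k { r3 := q.reverse } (Function.update (fun _ => []) 0 x) rfl
  have e : Function.update (Function.update (fun _ => []) 0 x) 1 (unary k) =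
      initStore x (unary k) [] := by
    funext i
    match i with
    | 0 => rfl
    | 1 => rfl
    | 2 => rfl
    | i + 3 => rfl
  rw [e] at a4
  have a5 : Runs (p.shift 16) (Regs.store { r3 := q.reverse } (initStore x (unary k) []))
      (Regs.store { r3 := q.reverse } s) t := ⟨t, le_rfl, h.shift 16 _⟩
  have a6 := move_down { r3 := q.reverse } s
  rw [hy] at a6
  have a7 : Runs (move 2 0)
      (Regs.store { r2 := y.reverse, r3 := q.reverse } (Function.update s 0 []))
      -- The second move undoes the reversal of the first.
      (Regs.store { r0 := y, r3 := q.reverse } (Function.update s 0 [])) (4 * y.length + 1) := by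
    refine ((Runs.moveR _ _ 2 0).mono ?_).congr ?_ <;> simp [Regs.get, Regs.set]
  have a8 := drain_down k' { r0 := y, r3 := q.reverse } (Function.update s 0 [])
    (by rw [← hk]; rfl)
  have a9 : Runs (move 3 2)
      (Regs.store { r0 := y, r1 := unary k', r3 := q.reverse }
        (Function.update (Function.update s 0 []) 1 []))
      (Regs.store { r0 := y, r1 := unary k', r2 := q }
        (Function.update (Function.update s 0 []) 1 [])) (4 * q.length + 1) := by
    refine ((Runs.moveR _ _ 3 2).mono ?_).congr ?_ <;> simp [Regs.get, Regs.set]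
  refine Runs.mono (a1.seq <| a2.seq <| a3.seq <| a4.seq <| a5.seq <| a6.seq <| a7.seq <|
    a8.seq <| a9.seq hmain) ?_
  omega

/-- The output length satisfies `b ≤ 2 * (D * Z)`, so the base of the cube is at most `5 * (D * Z)`
and contributes `500 * 125 = 62500`. The linear terms stay below `500 * (D * Z)`. -/
theorem time_bound {a b d k k' t D Z : ℕ} (ha : a ≤ Z) (hd : d ≤ Z) (hk : k ≤ D) (hk' : k' ≤ D)
    (hD : 0 < D) (hZ : 0 < Z) (ht : t ≤ D * Z) (hb : b ≤ a + t) :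
    500 * (b + k' + 2) ^ 3 + t + (8 * (a + b + d) + 3 * (k + k') + 8) ≤
      63000 * D ^ 3 * Z ^ 3 := by
  have h1 : Z ≤ D * Z := Nat.le_mul_of_pos_left Z hD
  have h2 : D ≤ D * Z := Nat.le_mul_of_pos_right D hZ
  have h3 : b + k' + 2 ≤ 5 * (D * Z) := by omega
  have h4 : (b + k' + 2) ^ 3 ≤ (5 * (D * Z)) ^ 3 := Nat.pow_le_pow_left h3 3
  have h5 : D * Z ≤ (D * Z) ^ 3 := Nat.le_self_pow (by omega) _
  rw [mul_pow] at h4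
  rw [mul_assoc, ← mul_pow]
  omega

/-- Any parameterized problem that reduces to weighted satisfiability reduces to the hedonic
diversity game problem, for every notion of stability between Nash stability and individual
stability. -/
theorem reducesToOracle_problem {stable : ∀ G : Instance, G.Outcome → Prop}
    (hs₁ : ∀ G P, Instance.NashStable P → stable G P)
    (hs₂ : ∀ G P, stable G P → Instance.IndividuallyStable P) {P : ParamProblem}
    (hP : ParamReduces P weightedTwoCNFSat) : ReducesToOracle P (problem stable) := by
  obtain ⟨g, ⟨p, f, c, hf, hp⟩, ⟨h, hh, hgh⟩, hiff⟩ := hP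
  have hparam : ∀ y m, (problem stable).param (formulaGame y m) = m + 6 := by
    intro y m
    change m + 2 + 2 + (formulaGame y m).numTypes = m + 6
    rw [formulaGame, numTypes_wordGame]
  -- `D` is a computable common bound for the time factor, the new parameter and the old one, and it
  -- is positive.
  obtain ⟨D, hD⟩ : ∃ D : ℕ → ℕ, D = fun k => f k + h k + k + 1 := ⟨_, rfl⟩
  have hDc : Computable D := by
    rw [hD]
    exact Primrec.nat_add.to_comp.comp (Primrec.nat_add.to_comp.comp
      (Primrec.nat_add.to_comp.comp hf hh) Computable.id) (Computable.const 1)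
  have hFc : Computable fun k => 63000 * D k ^ 3 := by
    have e : (fun k => 63000 * D k ^ 3) = fun k => 63000 * (D k * (D k * D k)) := by
      funext k
      ring
    rw [e]
    exact Primrec.nat_mul.to_comp.comp (Computable.const 63000)
      (Primrec.nat_mul.to_comp.comp hDc (Primrec.nat_mul.to_comp.comp hDc hDc))
  have key : ∀ (x : List Bool) (k : ℕ) (q : List Bool), ∃ hi : Store,
      ∀ (main : Prog) (s' : Store), Runs main
        (Regs.store { r0 := (g x k).1, r1 := unary (g x k).2, r2 := q } hi) s'
        (500 * ((g x k).1.length + (g x k).2 + 2) ^ 3) →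
      ∃ t, Exec (afterProg p main) (initStore x (unary k) q) s' t ∧
        t ≤ 63000 * D k ^ 3 * (x.length + q.length + 1) ^ ((c + 1) * 3) := by
    intro x k q
    obtain ⟨s, t, hexec, h0, h1, ht⟩ := hp x k
    obtain ⟨hi, hhi⟩ := runs_afterProg (q := q) hexec h0 h1
    refine ⟨hi, fun main s' hmain => ?_⟩
    obtain ⟨T, hT, hrun⟩ := hhi main s' _ hmain
    refine ⟨T, hrun, hT.trans ?_⟩
    rw [pow_mul]
    -- The exponent is `c + 1` rather than `c` so that the power bounds the length itself, also for
    -- `c = 0`.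
    have hz : x.length + q.length + 1 ≤ (x.length + q.length + 1) ^ (c + 1) :=
      Nat.le_self_pow (by omega) _
    have hlen : (s 0).length ≤ x.length + t := hexec.length_le 0
    rw [h0] at hlen
    have hDk : D k = f k + h k + k + 1 := by rw [hD]
    have hgk := hgh x k
    refine time_bound (by omega) (by omega) (by omega) (by omega) (by omega) (by positivity)
      (ht.trans ?_) hlen
    refine Nat.mul_le_mul (by omega) ?_
    exact (Nat.pow_le_pow_left (by omega) c).trans (Nat.pow_le_pow_right (by omega) (by omega))
  refine ⟨fun x k => formulaGame (g x k).1 (g x k).2, ⟨?_, ?_⟩, ⟨fun k => h k + 6, ?_, ?_⟩, ?_⟩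
  · refine ⟨afterProg p inputProg, fun k => 63000 * D k ^ 3, (c + 1) * 3, hFc, fun x k => ?_⟩
    obtain ⟨hi, hhi⟩ := key x k []
    obtain ⟨R, h0, h1, hR⟩ := runs_inputProg (g x k).1 (g x k).2 hi
    obtain ⟨t, hexec, ht⟩ := hhi inputProg _ (hR.mono (Nat.mul_le_mul (by omega)
      (Nat.pow_le_pow_left (by omega) 3)))
    exact ⟨_, t, hexec, h0, h1.trans (congrArg unary (hparam _ _).symm), ht⟩
  · refine ⟨afterProg p oracleProg, fun k => 63000 * D k ^ 3, (c + 1) * 3, hFc, fun x k q => ?_⟩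
    obtain ⟨hi, hhi⟩ := key x k ((problem stable).encQuery _ q)
    obtain ⟨R, b, h0, hb, hR⟩ := runs_oracleProg (g x k).1 (g x k).2 q hi
    obtain ⟨t, hexec, ht⟩ := hhi oracleProg _ hR
    exact ⟨_, t, b, hexec, h0, hb, ht⟩
  · exact Primrec.nat_add.to_comp.comp hh (Computable.const 6)
  · intro x k
    exact (hparam _ _).trans_le (Nat.add_le_add_right (hgh x k) 6)
  · intro x k
    exact (hiff x k).trans (formulaGame_yes_iff hs₁ hs₂ _ _)

end HDG

/-! ### The two extreme stability notions -/

theorem mainTheorem5 :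
    ParamComplexity.W1Hard HDG.nash ∧ ParamComplexity.W1Hard HDG.individual :=
  ⟨fun _ hP => HDG.reducesToOracle_problem (fun _ _ h => h)
      (fun _ _ h i C hC => h i C hC.1) hP,
    fun _ hP => HDG.reducesToOracle_problem (fun _ _ h i C hC => h i C hC.1)
      (fun _ _ h => h) hP⟩
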